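/- Let $q$ be a positive integer and let $f:\mathbb{Z}\to\mathbb{C}$ be $q$-periodic and even or odd, i.e. $f(n+q)=f(n)$ and $f(n)=\delta f(-n)$ for all $n\in\mathbb{Z}$, with $\delta=+1$ (even) or $\delta=-1$ (odd). Put $\mathrm{e}(z)=\exp(2\pi i z)$ and $$\Delta(s;f)=-i\left(\frac{q}{2\pi}\right)^{1-s}\frac{\Gamma(1-s)}{\sqrt q}\left(\mathrm{e}\!\left(\frac s4\right)-\delta\,\mathrm{e}\!\left(-\frac s4\right)\right),$$ the factor in the functional equation $L(s;f)=\Delta(s;f)L(1-s;f^+)$, where $L(s;f)$ is the meromorphic continuation of $\sum_{n\ge1}f(n)n^{-s}$ and $f^+(n)=q^{-1/2}\sum_{a\bmod q}f(a)\mathrm{e}(an/q)$. Then: 1. $\Delta(\cdot\,;f)$ is meromorphic in $\mathbb{C}$. 2. $\Delta(\cdot\,;f)$ has exactly the two exceptional values $0$ and $\infty$ in the sense of Nevanlinna theory: for $a\in\mathbb{C}\cup\{\infty\}$, the deficiency $1-\limsup_{r\to\infty}N(r,a)/T(r)$ is positive if and only if $a\in\{0,\infty\}$. Here $N(r,a)$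 is the integrated (logarithmic) counting function of the $a$-points of $\Delta(\cdot\,;f)$ (of its poles, if $a=\infty$), with multiplicity, and $T(r)$ is the Nevanlinna characteristic of $\Delta(\cdot\,;f)$. 3. The critical line $\frac12+i\mathbb{R}$ is a Julia line for $\Delta(\cdot\,;f)$: for every $\varepsilon>0$, the function takes every complex value, with at most one exception, infinitely often in the strip $|\operatorname{Re}s-\frac12|<\varepsilon$. 4. For every complex number $a\ne0$ and every real $T$ there are only finitely many solutions $s=\beta_a+i\gamma_a$ of $\Delta(s;f)=a$ with $0<\beta_a<1$ and $0<\gamma_a<T$, and their number $N_a(T;f)$, counted with multiplicity, satisfies, as $T\to\infty$, $$N_a(T;f)=\frac{T}{2\pi}\log\frac{qT}{2\pi e}+O(\log T),$$ where the implied constant may depend on $a$ and $f$ (including $q$ and $\delta$). -/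

import Mathlib

/-- The factor `Δ(s; f)` of the functional equation `L(s; f) = Δ(s; f) L(1 - s; f⁺)` for an
arithmetical function `f` of period `q` and parity `δ` (`δ = 1` for even, `δ = -1` for odd `f`):
`-i (q / 2π)^(1-s) Γ(1-s) / √q (e(s/4) - δ e(-s/4))`, where `e(z) = exp(2πiz)`.
It depends on `f` only through `q` and `δ`. The value which Lean assigns at the poles
`s = 1, 2, 3, …` of `Γ(1-s)` is immaterial: everything below is expressed through orders of
meromorphic functions, which do not see the value at a single point. -/
noncomputable def DeltaFactor (q : ℕ) (δ : ℤ) (s : ℂ) : ℂ :=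
  -Complex.I * ((q : ℂ) / (2 * (Real.pi : ℂ))) ^ (1 - s)
    * (Complex.Gamma (1 - s) / ((Real.sqrt (q : ℝ) : ℝ) : ℂ))
    * (Complex.exp (2 * (Real.pi : ℂ) * Complex.I * (s / 4))
        - (δ : ℂ) * Complex.exp (2 * (Real.pi : ℂ) * Complex.I * (-(s / 4))))

/-- `s` is an `a`-point of the meromorphic function `F`, i.e. `F(s) = a`
(where a removable singularity is removed): `F - a` has a zero at `s`. -/
def IsAPoint (F : ℂ → ℂ) (a s : ℂ) : Prop :=
  0 < meromorphicOrderAt (fun z => F z - a) s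

/-- The multiplicity of `s` as an `a`-point of the meromorphic function `F`
(it is `0` if `s` is not an `a`-point). -/
noncomputable def aPointMultiplicity (F : ℂ → ℂ) (a s : ℂ) : ℕ :=
  (meromorphicOrderAt (fun z => F z - a) s).untop₀.toNat

/-- The `a`-points `β + iγ` of `F` with `0 < β < 1` and `0 < γ < T`. -/
def aPointsInStrip (F : ℂ → ℂ) (a : ℂ) (T : ℝ) : Set ℂ :=
  {s | IsAPoint F a s ∧ 0 < s.re ∧ s.re < 1 ∧ 0 < s.im ∧ s.im < T}

/-- The number `N_a(T)` of `a`-points `β + iγ` of `F` with `0 < β < 1` and `0 < γ < T`,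
counted with multiplicity. -/
noncomputable def aPointCount (F : ℂ → ℂ) (a : ℂ) (T : ℝ) : ℕ :=
  ∑ᶠ s ∈ aPointsInStrip F a T, aPointMultiplicity F a s

/-- The Nevanlinna deficiency `1 - limsup_{r → ∞} N(r, a) / T(r)` of a value
`a ∈ ℂ ∪ {∞}` of a nonconstant meromorphic function `F` on `ℂ`, where `N(r, a)` is the
logarithmic counting function of the `a`-points (of the poles, if `a = ∞`) and `T(r)` is the
Nevanlinna characteristic. -/
noncomputable def nevanlinnaDeficiency (F : ℂ → ℂ) (a : WithTop ℂ) : ℝ :=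
  1 - Filter.limsup
    (fun r : ℝ =>
      ValueDistribution.logCounting F a r / ValueDistribution.characteristic F ⊤ r)
    Filter.atTop

/-- `a ∈ ℂ ∪ {∞}` is an exceptional value of `F` in the sense of Nevanlinna theory:
its deficiency is positive. -/
def IsNevanlinnaExceptional (F : ℂ → ℂ) (a : WithTop ℂ) : Prop :=
  0 < nevanlinnaDeficiency F a

/-- The vertical line `σ + iℝ` is a Julia line for `F`: in every open strip around the line,
`F` takes every complex value infinitely often, with at most one exceptional value. -/
def IsJuliaLine (F : ℂ → ℂ) (σ : ℝ) : Prop :=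
  ∀ ε : ℝ, 0 < ε →
    {a : ℂ | ¬ {s : ℂ | |s.re - σ| < ε ∧ IsAPoint F a s}.Infinite}.Subsingleton

/-! In the upper half plane the factor has neither zeros nor poles, so it equals `exp (-G)` with `G`
holomorphic. Stirling's formula for the digamma function gives `G' = log (qt/2π) + O(1/t)` in the
critical strip, and unimodularity on the critical line gives `Re G = 0` there. `IsCriticalPhase`
records just these facts.

Hence `a`-points with `a ≠ 0` are the points where `Re G = -log |a|` and `Im G ≡ -arg a` modulo
`2π`. As `G'` is nearly real and large, each level curve of `Re G` is, high up, a graph close to the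
critical line on which `Im G` increases (`exists_level_curve`). Counting `a`-points thus becomes
counting integers in an interval (`exists_count`). This yields the asymptotic formula for `N_a(T)`,
and also the Julia line, since these points lie arbitrarily close to the critical line and only `0`
can be omitted.

For the deficiencies, write the factor as an entire function of exponential type divided by
`1/Γ(1-s)`. Only the half plane `Re s > 0` contributes to the leading term, and the mean of `max (Re
s) 0` over a circle is `r/π`, so `T(r) ≤ r log r / π + O(r)` (`exists_characteristic_le`).
Conversely, the `a`-points in the strip and their mirror images in the lower half plane already give
`N(r, a) ≥ r log r / π - O(r)` (`exists_le_logCounting`). With the First Main Theorem, every `a ≠ 0,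
∞` has deficiency zero. Zeros and poles lie among the zeros of `sin πs`, so their counting functions
are `O(r)` and both deficiencies equal one. -/

open Filter Topology

/-! ### Euler's product for Γ, and Stirling's formula for the digamma function -/

namespace Complex

lemma norm_GammaSeq (z : ℂ) {n : ℕ} (hn : n ≠ 0) :
    ‖GammaSeq z n‖ = (n : ℝ) ^ z.re * (n.factorial : ℝ) / ∏ j ∈ Finset.range (n + 1), ‖z + j‖ := by
  rw [GammaSeq, norm_div, norm_mul, norm_prod, norm_natCast, norm_natCast_cpow_of_pos (by omega)]

lemma exp_logGammaSeq {x : ℝ} (hx : 0 < x) {n : ℕ} (hn : n ≠ 0) :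
    Real.exp (Real.BohrMollerup.logGammaSeq x n)
      = (n : ℝ) ^ x * (n.factorial : ℝ) / ∏ j ∈ Finset.range (n + 1), (x + j) := by
  have hn' : (0 : ℝ) < n := by positivity
  have hf : (0 : ℝ) < n.factorial := by positivity
  rw [Real.BohrMollerup.logGammaSeq, Real.exp_sub, Real.exp_add, Real.exp_sum, Real.exp_log hf,
    Real.rpow_def_of_pos hn', mul_comm x]
  congr 1
  exact Finset.prod_congr rfl fun j _ => Real.exp_log (by positivity)

/-- Each factor satisfies `|z + j| ≥ Re z + j`, and on the positive axis Euler's products stay below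
`Γ` by logarithmic convexity. Being uniform in `n`, the bound serves as a dominating function below.
-/
lemma norm_GammaSeq_le_Gamma_re {z : ℂ} (hz : 0 < z.re) {n : ℕ} (hn : n ≠ 0) :
    ‖GammaSeq z n‖ ≤ Real.Gamma z.re := by
  have h1 : ‖GammaSeq z n‖ ≤ Real.exp (Real.BohrMollerup.logGammaSeq z.re n) := by
    rw [norm_GammaSeq z hn, exp_logGammaSeq hz hn]
    gcongr with j hj
    simpa using (re_le_norm (z + j))
  refine h1.trans ?_
  rw [← Real.le_log_iff_exp_le (Real.Gamma_pos_of_pos hz)]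
  have := Real.BohrMollerup.ge_logGammaSeq Real.convexOn_log_Gamma (x := z.re) (n := n)
    (fun {y} hy => by
      rw [Function.comp_apply, Real.Gamma_add_one hy.ne',
        Real.log_mul hy.ne' (Real.Gamma_pos_of_pos hy).ne', add_comm, Function.comp_apply]) hz hn
  simpa using this

lemma norm_Gamma_le_Gamma_re {z : ℂ} (hz : 0 < z.re) : ‖Gamma z‖ ≤ Real.Gamma z.re := by
  refine le_of_tendsto (GammaSeq_tendsto_Gamma z).norm ?_
  filter_upwards [eventually_ne_atTop 0] with n hn using norm_GammaSeq_le_Gamma_re hz hn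

/-- On vertical lines to the right of `1/2`, the Gamma function decays at most as fast as it does
on the line `Re z = 1/2`. -/
lemma Gamma_re_mul_norm_Gamma_half_le {z : ℂ} (hz : 1 / 2 ≤ z.re) :
    Real.Gamma z.re * ‖Gamma (1 / 2 + z.im * I)‖ ≤ Real.Gamma (1 / 2) * ‖Gamma z‖ := by
  have hx : 0 < z.re := by linarith
  refine le_of_tendsto_of_tendsto
    ((Real.GammaSeq_tendsto_Gamma z.re).mul (GammaSeq_tendsto_Gamma (1 / 2 + z.im * I)).norm)
    ((Real.GammaSeq_tendsto_Gamma (1 / 2)).mul (GammaSeq_tendsto_Gamma z).norm) ?_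
  filter_upwards [eventually_ne_atTop 0] with n hn
  have hn' : (0 : ℝ) < n := by positivity
  simp only [norm_GammaSeq _ hn, Real.GammaSeq]
  have e : (1 / 2 + (z.im : ℂ) * I).re = 1 / 2 := by simp
  rw [e, div_mul_div_comm, div_mul_div_comm, ← Finset.prod_mul_distrib, ← Finset.prod_mul_distrib]
  have hnum : (n : ℝ) ^ z.re * n.factorial * ((n : ℝ) ^ (1 / 2 : ℝ) * n.factorial)
      = (n : ℝ) ^ (1 / 2 : ℝ) * n.factorial * ((n : ℝ) ^ z.re * n.factorial) := by ring
  rw [hnum]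
  refine div_le_div_of_nonneg_left (by positivity) ?_ ?_
  · refine Finset.prod_pos fun j _ => mul_pos (by positivity) ?_
    refine norm_pos_iff.2 fun h => ?_
    have := congrArg re h
    simp at this
    have : (0 : ℝ) ≤ j := by positivity
    linarith
  -- Factor by factor: for fixed `y`, the ratio `|σ + iy| / σ` decreases in `σ > 0`.
  · refine Finset.prod_le_prod (fun j _ => by positivity) fun j _ => ?_
    have hj : (0 : ℝ) ≤ j := by positivity
    rw [← sq_le_sq₀ (by positivity) (by positivity), mul_pow, mul_pow, Complex.sq_norm, Complex.sq_norm,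
      normSq_apply, normSq_apply]
    simp
    have : (1 / 2 + (j : ℝ)) ≤ z.re + j := by linarith
    have h2 : (1 / 2 + (j : ℝ)) ^ 2 ≤ (z.re + j) ^ 2 := by gcongr
    norm_num at h2
    nlinarith [mul_le_mul_of_nonneg_right h2 (mul_self_nonneg z.im)]

/-- On the critical line `1 - s` is the conjugate of `s`, so the reflection formula computes
`|Γ(s)|²`. -/
lemma norm_sq_Gamma_half_add_mul_I (y : ℝ) :
    ‖Gamma (1 / 2 + y * I)‖ ^ 2 = Real.pi / Real.cosh (Real.pi * y) := by
  have h := Gamma_mul_Gamma_one_sub (1 / 2 + y * I)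
  have e1 : (1 - (1 / 2 + y * I) : ℂ) = (starRingEnd ℂ) (1 / 2 + y * I) := by
    apply Complex.ext <;> simp; norm_num
  have e2 : (Real.pi : ℂ) * (1 / 2 + y * I) = (Real.pi / 2 : ℂ) + (Real.pi * y : ℝ) * I := by
    push_cast; ring
  rw [e1, Gamma_conj, mul_conj, e2, add_comm (Real.pi / 2 : ℂ), sin_add_pi_div_two, cos_mul_I,
    ← ofReal_cosh, ← ofReal_div] at h
  rw [Complex.sq_norm]
  exact_mod_cast h

/-- The sequence of logarithmic derivatives of Euler's products for the Gamma function. -/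
lemma logDeriv_GammaSeq {z : ℂ} (hz : 0 < z.re) {n : ℕ} (hn : n ≠ 0) :
    logDeriv (fun w => GammaSeq w n) z
      = Real.log n - ∑ j ∈ Finset.range (n + 1), 1 / (z + j) := by
  have hn' : (n : ℂ) ≠ 0 := by exact_mod_cast hn
  have hne : ∀ j : ℕ, z + j ≠ 0 := fun j h => by
    have := congrArg re h
    simp at this
    have : (0 : ℝ) ≤ j := by positivity
    linarith
  have hd : DifferentiableAt ℂ (fun w : ℂ => (n : ℂ) ^ w) z :=
    differentiableAt_id.const_cpow (Or.inl hn')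
  have hp : ∏ j ∈ Finset.range (n + 1), (z + j) ≠ 0 := Finset.prod_ne_zero_iff.2 fun j _ => hne j
  unfold GammaSeq
  rw [logDeriv_div (f := fun w : ℂ => (n : ℂ) ^ w * n.factorial)
    (g := fun w : ℂ => ∏ j ∈ Finset.range (n + 1), (w + j)) z
    (mul_ne_zero (by simp [cpow_eq_zero_iff, hn']) (by exact_mod_cast n.factorial_ne_zero)) hp
    (hd.mul_const _) (by fun_prop),
    logDeriv_mul_const _ _ (by exact_mod_cast n.factorial_ne_zero),
    logDeriv_prod (fun j _ => hne j) (fun j _ => by fun_prop)]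
  congr 1
  · rw [logDeriv_apply, (show HasDerivAt (fun w : ℂ => (n : ℂ) ^ w) _ z from
      (hasDerivAt_id z).const_cpow (Or.inl hn')).deriv]
    have : (n : ℂ) ^ z ≠ 0 := by simp [cpow_eq_zero_iff, hn']
    rw [ofReal_log (by positivity)]
    simp only [id, mul_one, ofReal_natCast]
    field_simp
  · refine Finset.sum_congr rfl fun j _ => ?_
    rw [logDeriv_apply]
    simp

lemma differentiableOn_GammaSeq {n : ℕ} (hn : n ≠ 0) :
    DifferentiableOn ℂ (fun w => GammaSeq w n) {z | 0 < z.re} := by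
  intro z hz
  have hn' : (n : ℂ) ≠ 0 := by exact_mod_cast hn
  have hne : ∀ j : ℕ, z + j ≠ 0 := fun j h => by
    have := congrArg re h
    simp at this
    have : (0 : ℝ) ≤ j := by positivity
    have : 0 < z.re := hz
    linarith
  have hd : DifferentiableAt ℂ (fun w : ℂ => (n : ℂ) ^ w) z :=
    differentiableAt_id.const_cpow (Or.inl hn')
  unfold GammaSeq
  exact ((hd.mul_const _).div (by fun_prop)
    (Finset.prod_ne_zero_iff.2 fun j _ => hne j)).differentiableWithinAt

/-- Cauchy's formula writes the derivative as an integral over a circle inside the right half plane;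
pointwise convergence and the bound by `Γ(Re w)` allow dominated convergence. -/
lemma tendsto_deriv_GammaSeq {z : ℂ} (hz : 0 < z.re) :
    Tendsto (fun n => deriv (fun w => GammaSeq w n) z) atTop (𝓝 (deriv Gamma z)) := by
  have hopen : IsOpen {w : ℂ | 0 < w.re} := isOpen_lt continuous_const continuous_re
  set R : ℝ := z.re / 2
  have hR : 0 < R := half_pos hz
  have hsub : Metric.closedBall z R ⊆ {w : ℂ | 0 < w.re} := by
    intro w hw
    rw [Metric.mem_closedBall, dist_eq_norm] at hw
    have := (abs_re_le_norm (w - z)).trans hw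
    rw [sub_re, abs_le] at this
    simp only [R, Set.mem_ofPred_eq] at *
    linarith [this.1]
  have hG : DifferentiableOn ℂ Gamma {w : ℂ | 0 < w.re} := fun w hw =>
    (differentiableAt_Gamma w fun m h => by
      have h1 : w.re = -m := by rw [h]; simp
      have h2 : 0 < w.re := hw
      have : (0 : ℝ) ≤ m := by positivity
      linarith).differentiableWithinAt
  have hzb : z ∈ Metric.ball z R := Metric.mem_ball_self hR
  rw [← two_pi_I_inv_smul_circleIntegral_sub_sq_inv_smul_of_differentiable hopen hsub hG hzb]
  obtain ⟨M, hM⟩ : ∃ M, ∀ w ∈ Metric.sphere z R, ‖Real.Gamma w.re‖ ≤ M := by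
    refine (isCompact_sphere z R).exists_bound_of_continuousOn ?_
    refine Real.differentiableOn_Gamma_Ioi.continuousOn.comp continuous_re.continuousOn ?_
    intro w hw
    exact hsub (Metric.sphere_subset_closedBall hw)
  have hmem : ∀ θ : ℝ, circleMap z R θ ∈ Metric.sphere z R := fun θ =>
    circleMap_mem_sphere z hR.le θ
  have key : Tendsto (fun n => (2 * Real.pi * I : ℂ)⁻¹ •
      ∮ w in C(z, R), ((w - z) ^ 2)⁻¹ • GammaSeq w n) atTop
      (𝓝 ((2 * Real.pi * I : ℂ)⁻¹ • ∮ w in C(z, R), ((w - z) ^ 2)⁻¹ • Gamma w)) := by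
    refine Tendsto.const_smul ?_ _
    unfold circleIntegral
    refine intervalIntegral.tendsto_integral_filter_of_dominated_convergence
      (fun _ => R * ((R ^ 2)⁻¹ * M)) ?_ ?_ (by simp) ?_
    · filter_upwards [eventually_ne_atTop 0] with n hn
      refine Continuous.aestronglyMeasurable ?_
      have hc : Continuous fun θ : ℝ => GammaSeq (circleMap z R θ) n :=
        ((differentiableOn_GammaSeq hn).continuousOn).comp_continuous (continuous_circleMap z R)
          fun θ => hsub (Metric.sphere_subset_closedBall (hmem θ))
      simp only [deriv_circleMap, circleMap_sub_center]
      refine ((continuous_circleMap 0 R).mul continuous_const).smul (Continuous.smul (f := fun θ => (circleMap 0 R θ ^ 2)⁻¹) ?_ hc)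
      refine ((continuous_circleMap 0 R).pow 2).inv₀ fun θ => ?_
      exact pow_ne_zero _ (circleMap_ne_center hR.ne')
    · filter_upwards [eventually_ne_atTop 0] with n hn
      refine Eventually.of_forall fun θ _ => ?_
      simp only [deriv_circleMap, circleMap_sub_center, norm_smul, norm_mul, norm_I, mul_one,
        norm_circleMap_zero, abs_of_pos hR, norm_inv, norm_pow]
      gcongr
      exact (norm_GammaSeq_le_Gamma_re (hsub (Metric.sphere_subset_closedBall (hmem θ))) hn).trans
        ((le_abs_self _).trans (hM _ (hmem θ)))
    · refine Eventually.of_forall fun θ _ => ?_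
      exact ((GammaSeq_tendsto_Gamma _).const_smul _).const_smul _
  refine key.congr' ?_
  filter_upwards [eventually_ne_atTop 0] with n hn
  exact two_pi_I_inv_smul_circleIntegral_sub_sq_inv_smul_of_differentiable hopen hsub
    (differentiableOn_GammaSeq hn) hzb

lemma tendsto_digamma {z : ℂ} (hz : 0 < z.re) :
    Tendsto (fun n : ℕ => (Real.log n : ℂ) - ∑ j ∈ Finset.range (n + 1), 1 / (z + j)) atTop
      (𝓝 (digamma z)) := by
  have h := (tendsto_deriv_GammaSeq hz).div (GammaSeq_tendsto_Gamma z) (Gamma_ne_zero_of_re_pos hz)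
  rw [digamma_def, logDeriv_apply]
  refine h.congr' ?_
  filter_upwards [eventually_ne_atTop 0] with n hn
  rw [← logDeriv_GammaSeq hz hn, logDeriv_apply]
  rfl

/-- Mean value inequality for `log (w + u) - u / w` on `0 ≤ u ≤ 1`: its derivative is `-u / (w (w +
u))`, and `|w + u| ≥ |w|`. -/
lemma norm_log_add_one_sub_log_sub_inv_le {w : ℂ} (hw : 0 < w.re) :
    ‖log (w + 1) - log w - 1 / w‖ ≤ 1 / ‖w‖ ^ 2 := by
  have hw0 : w ≠ 0 := fun h => by simp [h] at hw
  have hu : ∀ u ∈ Set.Icc (0 : ℝ) 1, 0 < (w + u).re := fun u hu => by simp; linarith [hu.1]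
  have key := norm_image_sub_le_of_norm_deriv_le_segment_01'
    (f := fun u : ℝ => log (w + u) - u / w) (f' := fun u => 1 / (w + u) - 1 / w)
    (C := 1 / ‖w‖ ^ 2) ?_ ?_
  · simpa [sub_sub, sub_right_comm, add_comm] using key
  · intro u hu'
    refine HasDerivAt.hasDerivWithinAt (HasDerivAt.sub ?_ ?_)
    · exact (((hasDerivAt_id u).ofReal_comp).const_add w).clog_real (Or.inl (hu u hu'))
    · simpa using ((hasDerivAt_id u).ofReal_comp).div_const w
  · intro u hu'
    have hu1 : u ∈ Set.Icc (0 : ℝ) 1 := ⟨hu'.1, hu'.2.le⟩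
    have hne : w + u ≠ 0 := fun h => by have := hu u hu1; simp [h] at this
    have e : 1 / (w + u) - 1 / w = -u / (w * (w + u)) := by field_simp; ring
    rw [e, norm_div, norm_mul, norm_neg, norm_real, sq]
    have h1 : ‖w‖ ≤ ‖w + u‖ := by
      rw [← sq_le_sq₀ (norm_nonneg _) (norm_nonneg _), Complex.sq_norm, Complex.sq_norm, normSq_apply, normSq_apply]
      simp
      nlinarith [hu'.1, mul_nonneg hw.le hu'.1, mul_self_nonneg u]
    have h2 : ‖u‖ ≤ 1 := by rw [Real.norm_of_nonneg hu'.1]; exact hu'.2.le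
    have : 0 < ‖w‖ := norm_pos_iff.2 hw0
    gcongr

lemma norm_sum_inv_sub_log_le {z : ℂ} (hz : 0 < z.re) (ht : 1 ≤ |z.im|) (n : ℕ) :
    ‖log (z + n) - log z - ∑ j ∈ Finset.range n, 1 / (z + j)‖ ≤ 4 / |z.im| := by
  set t := |z.im|
  -- The errors `1 / |z + n|²` are summed by telescoping: `(n + t)² ≤ 2 (n² + t²)` bounds each by `2
  -- / ((n + t)² - 1/4)`, a difference of consecutive terms.
  have key : ‖log (z + n) - log z - ∑ j ∈ Finset.range n, 1 / (z + j)‖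
      ≤ 2 * (1 / (t - 1 / 2) - 1 / (n + t - 1 / 2)) := by
    induction n with
    | zero => simp
    | succ n ih =>
      have hn : (0 : ℝ) ≤ n := by positivity
      have hw : 0 < (z + n).re := by simp; linarith
      have h1 := norm_log_add_one_sub_log_sub_inv_le hw
      rw [Finset.sum_range_succ]
      have e : log (z + (n + 1 : ℕ)) - log z - (∑ j ∈ Finset.range n, 1 / (z + j) + 1 / (z + n))
          = (log (z + n) - log z - ∑ j ∈ Finset.range n, 1 / (z + j))
            + (log (z + n + 1) - log (z + n) - 1 / (z + n)) := by push_cast; ring_nf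
      rw [e]
      refine (norm_add_le _ _).trans ((add_le_add ih h1).trans ?_)
      have hsq : (n : ℝ) ^ 2 + t ^ 2 ≤ ‖z + n‖ ^ 2 := by
        rw [Complex.sq_norm, normSq_apply]
        simp only [t, sq_abs]
        simp
        nlinarith
      have h2 : 1 / ‖z + n‖ ^ 2 ≤ 2 / ((n + t - 1 / 2) * (n + t + 1 / 2)) := by
        have hpos : 0 < (n + t - 1 / 2) * (n + t + 1 / 2) :=
          mul_pos (by linarith) (by linarith)
        rw [div_le_div_iff₀ (by nlinarith) hpos]
        nlinarith [sq_nonneg ((n : ℝ) - t)]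
      have e2 : 2 / ((n + t - 1 / 2) * (n + t + 1 / 2))
          = 2 * (1 / (n + t - 1 / 2) - 1 / (n + 1 + t - 1 / 2)) := by
        have h3 : (n + 1 + t - 1 / 2) = (n + t - 1 / 2) + 1 := by ring
        have h4 : (n + t + 1 / 2) = (n + t - 1 / 2) + 1 := by ring
        rw [h3, h4]
        have h5 : 0 < (n + t - 1 / 2) := by linarith
        generalize (n + t - 1 / 2) = b at h5
        field_simp
        ring
      push_cast
      linarith
  refine key.trans ?_
  have hn : (0 : ℝ) ≤ n := by positivity
  have h1 : 0 ≤ 1 / (n + t - 1 / 2) := by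
    apply div_nonneg zero_le_one; linarith
  have h2 : 1 / (t - 1 / 2) ≤ 2 / t := by
    rw [div_le_div_iff₀ (by linarith) (by linarith)]; linarith
  have h3 : 4 / t = 2 * (2 / t) := by ring
  linarith

lemma tendsto_log_natCast_sub_log_add {z : ℂ} :
    Tendsto (fun n : ℕ => (Real.log n : ℂ) - log (z + n)) atTop (𝓝 0) := by
  have h1 : Tendsto (fun n : ℕ => 1 + z / n) atTop (𝓝 (1 + 0)) :=
    tendsto_const_nhds.add (tendsto_const_div_atTop_nhds_zero_nat z)
  rw [add_zero] at h1
  have h2 := (h1.clog one_mem_slitPlane).neg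
  rw [log_one, neg_zero] at h2
  refine h2.congr' ?_
  have h3 : ∀ᶠ n : ℕ in atTop, 1 + z / n ≠ 0 := h1.eventually_ne one_ne_zero
  filter_upwards [eventually_ne_atTop 0, h3] with n hn hne
  have hn' : (n : ℂ) ≠ 0 := by exact_mod_cast hn
  have e : z + n = ((n : ℝ) : ℂ) * (1 + z / n) := by
    push_cast; field_simp; ring
  rw [e, log_ofReal_mul (by positivity) hne]
  ring

/-- The leading term of Stirling's formula for the digamma function in the right half plane. -/
lemma norm_digamma_sub_log_le {z : ℂ} (hz : 0 < z.re) (ht : 1 ≤ |z.im|) :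
    ‖digamma z - log z‖ ≤ 4 / |z.im| := by
  have h1 := (tendsto_digamma hz).sub_const (log z)
  have h2 : Tendsto (fun n : ℕ => (Real.log n : ℂ) - log (z + n)) atTop (𝓝 0) :=
    tendsto_log_natCast_sub_log_add
  -- The sum in `tendsto_digamma` has one term more than the estimated one; that term vanishes in
  -- the limit.
  have h3 : Tendsto (fun n : ℕ => 1 / (z + n)) atTop (𝓝 0) := by
    simp only [one_div]
    exact tendsto_inv₀_cobounded.comp
      ((tendsto_const_add_cobounded z).comp tendsto_natCast_atTop_cobounded)
  have h4 := h1.sub (h2.sub h3)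
  simp only [sub_zero] at h4
  refine le_of_tendsto h4.norm (Eventually.of_forall fun n => ?_)
  refine le_trans (le_of_eq ?_) (norm_sum_inv_sub_log_le hz ht n)
  rw [Finset.sum_range_succ]
  congr 1
  ring

end Complex

/-! ### The factor Δ: symmetry, modulus on the critical line, logarithmic derivative -/

open Complex in
/-- The trigonometric factor `e(s/4) - δ e(-s/4)` of `DeltaFactor`. -/
noncomputable def trigFactor (δ : ℤ) (s : ℂ) : ℂ :=
  exp (2 * (Real.pi : ℂ) * I * (s / 4)) - (δ : ℂ) * exp (2 * (Real.pi : ℂ) * I * (-(s / 4)))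

namespace DeltaFactor
open Complex

variable {q : ℕ} {δ : ℤ}

lemma eq_mul (q : ℕ) (δ : ℤ) (s : ℂ) :
    DeltaFactor q δ s = -I * ((q : ℂ) / (2 * (Real.pi : ℂ))) ^ (1 - s)
      * (Gamma (1 - s) / ((Real.sqrt (q : ℝ) : ℝ) : ℂ)) * trigFactor δ s := rfl

lemma base_eq (q : ℕ) : (q : ℂ) / (2 * (Real.pi : ℂ)) = ((q / (2 * Real.pi) : ℝ) : ℂ) := by
  push_cast; rfl

lemma base_ne_zero (hq : 0 < q) : (q : ℂ) / (2 * (Real.pi : ℂ)) ≠ 0 := by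
  have : (0 : ℝ) < q / (2 * Real.pi) := by positivity
  rw [base_eq]
  exact_mod_cast this.ne'

lemma sqrt_ne_zero (hq : 0 < q) : ((Real.sqrt (q : ℝ) : ℝ) : ℂ) ≠ 0 := by
  have : (0 : ℝ) < Real.sqrt q := by positivity
  exact_mod_cast this.ne'

lemma norm_exp_quarter (s : ℂ) :
    ‖exp (2 * (Real.pi : ℂ) * I * (s / 4))‖ = Real.exp (-(Real.pi / 2) * s.im) := by
  rw [norm_exp]
  congr 1
  simp [div_ofNat_im, div_ofNat_re]
  ring

lemma norm_exp_neg_quarter (s : ℂ) :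
    ‖exp (2 * (Real.pi : ℂ) * I * (-(s / 4)))‖ = Real.exp (Real.pi / 2 * s.im) := by
  rw [norm_exp]
  congr 1
  simp [div_ofNat_im, div_ofNat_re]
  ring

lemma norm_delta (hδ : δ = 1 ∨ δ = -1) : ‖(δ : ℂ)‖ = 1 := by
  rcases hδ with rfl | rfl <;> simp

/-- Off the real axis the two exponentials have different moduli `exp (∓πt/2)`. -/
lemma trigFactor_ne_zero (hδ : δ = 1 ∨ δ = -1) {s : ℂ} (hs : s.im ≠ 0) : trigFactor δ s ≠ 0 := by
  intro h
  have h1 := congrArg norm (sub_eq_zero.1 h)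
  rw [norm_mul, norm_delta hδ, norm_exp_quarter, norm_exp_neg_quarter, one_mul, Real.exp_eq_exp] at h1
  have : Real.pi * s.im = 0 := by linarith
  rcases mul_eq_zero.1 this with h2 | h2
  · exact Real.pi_ne_zero h2
  · exact hs h2

lemma differentiable_trigFactor (δ : ℤ) : Differentiable ℂ (trigFactor δ) := by
  unfold trigFactor; fun_prop

lemma one_sub_ne_neg_natCast {s : ℂ} (hs : s.im ≠ 0) (m : ℕ) : 1 - s ≠ -m := by
  intro h
  have := congrArg im h
  simp at this
  exact hs this

lemma differentiable_base (hq : 0 < q) :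
    Differentiable ℂ fun s : ℂ => ((q : ℂ) / (2 * (Real.pi : ℂ))) ^ (1 - s) := fun _ =>
  ((differentiableAt_const _).sub differentiableAt_id).const_cpow (Or.inl (base_ne_zero hq))

lemma differentiableAt_Gamma_one_sub {s : ℂ} (hs : s.im ≠ 0) :
    DifferentiableAt ℂ (fun s => Gamma (1 - s)) s :=
  (differentiableAt_Gamma _ (one_sub_ne_neg_natCast hs)).comp s
    ((differentiableAt_const _).sub differentiableAt_id)

lemma differentiableAt (hq : 0 < q) {s : ℂ} (hs : s.im ≠ 0) :
    DifferentiableAt ℂ (DeltaFactor q δ) s := by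
  have h : DifferentiableAt ℂ (fun s => -I * ((q : ℂ) / (2 * (Real.pi : ℂ))) ^ (1 - s)
      * (Gamma (1 - s) / ((Real.sqrt (q : ℝ) : ℝ) : ℂ)) * trigFactor δ s) s :=
    (((differentiable_base hq s).const_mul _).mul
      ((differentiableAt_Gamma_one_sub hs).div_const _)).mul (differentiable_trigFactor δ s)
  exact h

lemma ne_zero (hq : 0 < q) (hδ : δ = 1 ∨ δ = -1) {s : ℂ} (hs : s.im ≠ 0) :
    DeltaFactor q δ s ≠ 0 := by
  rw [eq_mul]
  refine mul_ne_zero (mul_ne_zero (mul_ne_zero (neg_ne_zero.2 I_ne_zero) ?_)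
    (div_ne_zero (Gamma_ne_zero (one_sub_ne_neg_natCast hs)) (sqrt_ne_zero hq)))
    (trigFactor_ne_zero hδ hs)
  simp [cpow_eq_zero_iff, base_ne_zero hq]

lemma meromorphic (hq : 0 < q) (δ : ℤ) : Meromorphic (DeltaFactor q δ) := by
  have h1 : Meromorphic fun s : ℂ => -I * ((q : ℂ) / (2 * (Real.pi : ℂ))) ^ (1 - s) := fun s =>
    (((differentiable_base hq).const_mul (-I)).analyticAt s).meromorphicAt
  have h2 : Meromorphic fun s : ℂ => (Gamma (1 - s))⁻¹ := fun s =>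
    ((differentiable_one_div_Gamma.comp
      ((differentiable_const (1 : ℂ)).sub differentiable_id)).analyticAt s).meromorphicAt
  have h3 : Meromorphic fun s : ℂ => Gamma (1 - s) / ((Real.sqrt (q : ℝ) : ℝ) : ℂ) := fun s => by
    refine ((h2 s).inv.div (MeromorphicAt.const ((Real.sqrt (q : ℝ) : ℝ) : ℂ) s)).congr ?_
    exact Eventually.of_forall fun z => by simp
  have h4 : Meromorphic (trigFactor δ) := fun s =>
    ((differentiable_trigFactor δ).analyticAt s).meromorphicAt
  exact fun s => ((h1 s).mul (h3 s)).mul (h4 s)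

lemma conj_trigFactor (δ : ℤ) (hδ : δ = 1 ∨ δ = -1) (s : ℂ) :
    trigFactor δ (starRingEnd ℂ s) = -δ * starRingEnd ℂ (trigFactor δ s) := by
  unfold trigFactor
  rw [map_sub, map_mul, ← exp_conj, ← exp_conj]
  simp only [map_mul, map_div₀, map_neg, conj_I, conj_ofReal, map_ofNat, map_intCast]
  rcases hδ with rfl | rfl <;> push_cast <;> ring_nf

/-- The reflection symmetry of `Δ` in the real axis. -/
lemma conj_apply (hq : 0 < q) (hδ : δ = 1 ∨ δ = -1) (s : ℂ) :
    DeltaFactor q δ (starRingEnd ℂ s) = δ * starRingEnd ℂ (DeltaFactor q δ s) := by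
  have h1 : ((q : ℂ) / (2 * (Real.pi : ℂ))) ^ (1 - starRingEnd ℂ s)
      = starRingEnd ℂ (((q : ℂ) / (2 * (Real.pi : ℂ))) ^ (1 - s)) := by
    have hpos : (0 : ℝ) < q / (2 * Real.pi) := by positivity
    have e : 1 - starRingEnd ℂ s = starRingEnd ℂ (1 - s) := by simp
    rw [base_eq, e, cpow_conj, conj_ofReal]
    · rw [arg_ofReal_of_nonneg hpos.le]; exact Real.pi_ne_zero.symm
  have h2 : Gamma (1 - starRingEnd ℂ s) = starRingEnd ℂ (Gamma (1 - s)) := by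
    rw [← Gamma_conj]; simp
  rw [eq_mul, eq_mul, h1, h2, conj_trigFactor δ hδ]
  simp only [map_mul, map_div₀, map_neg, conj_I, conj_ofReal]
  ring

/-- `Δ` is unimodular on the critical line. -/
lemma norm_half_add_mul_I (hq : 0 < q) (hδ : δ = 1 ∨ δ = -1) (t : ℝ) :
    ‖DeltaFactor q δ (1 / 2 + t * I)‖ = 1 := by
  have hpos : (0 : ℝ) < q / (2 * Real.pi) := by positivity
  have hq' : (0 : ℝ) < q := by positivity
  have h1 : ‖((q : ℂ) / (2 * (Real.pi : ℂ))) ^ (1 - (1 / 2 + t * I))‖ ^ 2 = q / (2 * Real.pi) := by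
    rw [base_eq, norm_cpow_eq_rpow_re_of_pos hpos, ← Real.rpow_natCast, ← Real.rpow_mul hpos.le]
    norm_num
  have h2 : ‖Gamma (1 - (1 / 2 + t * I))‖ ^ 2 = Real.pi / Real.cosh (Real.pi * t) := by
    have e : (1 - (1 / 2 + t * I) : ℂ) = 1 / 2 + ((-t : ℝ) : ℂ) * I := by push_cast; ring
    rw [e, norm_sq_Gamma_half_add_mul_I]
    simp
  -- On this line the two exponentials have phases `±π/4`, which are orthogonal, so the cross term
  -- drops out.
  have h3 : ‖trigFactor δ (1 / 2 + t * I)‖ ^ 2 = 2 * Real.cosh (Real.pi * t) := by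
    unfold trigFactor
    have hE : exp (2 * (Real.pi : ℂ) * I * ((1 / 2 + t * I) / 4))
        = exp ((Real.pi / 4 : ℝ) * I) * (Real.exp (-(Real.pi / 2 * t)) : ℝ) := by
      rw [ofReal_exp, ← exp_add]; congr 1; push_cast; ring_nf; simp; ring
    have hE' : exp (2 * (Real.pi : ℂ) * I * (-((1 / 2 + t * I) / 4)))
        = exp ((-(Real.pi / 4) : ℝ) * I) * (Real.exp (Real.pi / 2 * t) : ℝ) := by
      rw [ofReal_exp, ← exp_add]; congr 1; push_cast; ring_nf; simp; ring
    have hA : Real.exp (-(Real.pi / 2 * t)) * Real.exp (Real.pi / 2 * t) = 1 := by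
      rw [← Real.exp_add]; simp
    have hc : 2 * Real.cosh (Real.pi * t)
        = Real.exp (Real.pi / 2 * t) ^ 2 + Real.exp (-(Real.pi / 2 * t)) ^ 2 := by
      rw [Real.cosh_eq, ← Real.exp_nat_mul, ← Real.exp_nat_mul]; push_cast; ring_nf
    rw [hc, hE, hE', exp_mul_I, exp_mul_I, ← ofReal_cos, ← ofReal_sin, ← ofReal_cos, ← ofReal_sin,
      Real.cos_neg, Real.sin_neg, Real.cos_pi_div_four, Real.sin_pi_div_four, Complex.sq_norm,
      normSq_apply]
    have hr : Real.sqrt 2 ^ 2 = 2 := Real.sq_sqrt (by norm_num)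
    generalize Real.exp (-(Real.pi / 2 * t)) = a at *
    generalize Real.exp (Real.pi / 2 * t) = b at *
    rcases hδ with rfl | rfl <;> simp <;> ring_nf <;> rw [hr] <;> ring
  have h4 : ‖((Real.sqrt (q : ℝ) : ℝ) : ℂ)‖ ^ 2 = q := by
    rw [norm_real, Real.norm_eq_abs, sq_abs, Real.sq_sqrt hq'.le]
  have h5 : ‖DeltaFactor q δ (1 / 2 + t * I)‖ ^ 2 = 1 := by
    rw [eq_mul, norm_mul, norm_mul, norm_mul, norm_div, norm_neg, norm_I, mul_pow, mul_pow, mul_pow,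
      div_pow, h1, h2, h3, h4]
    have := Real.cosh_pos (Real.pi * t)
    have := Real.pi_pos
    field_simp
  exact (pow_eq_one_iff_of_nonneg (norm_nonneg _) two_ne_zero).1 h5

lemma hasDerivAt_trigFactor (δ : ℤ) (s : ℂ) :
    HasDerivAt (trigFactor δ) ((Real.pi * I / 2) * (exp (2 * (Real.pi : ℂ) * I * (s / 4))
      + (δ : ℂ) * exp (2 * (Real.pi : ℂ) * I * (-(s / 4))))) s := by
  have h1 : HasDerivAt (fun s : ℂ => s / 4) (1 / 4) s := (hasDerivAt_id s).div_const 4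
  have h2 := ((h1.const_mul (2 * (Real.pi : ℂ) * I)).cexp).sub
    (((h1.neg).const_mul (2 * (Real.pi : ℂ) * I)).cexp.const_mul (δ : ℂ))
  refine h2.congr_deriv ?_
  simp only [Pi.neg_apply]
  ring

/-- In the upper half plane `e(-s/4)` dominates, and its logarithmic derivative is `-πi/2`. The true
error is exponentially small; `2 / t` is enough. -/
lemma norm_logDeriv_trigFactor_add_le (hδ : δ = 1 ∨ δ = -1) {s : ℂ} (hs : 1 ≤ s.im) :
    ‖logDeriv (trigFactor δ) s + Real.pi * I / 2‖ ≤ 2 / s.im := by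
  have hne := trigFactor_ne_zero hδ (s := s) (by linarith)
  rw [logDeriv_apply, (hasDerivAt_trigFactor δ s).deriv]
  have e : (Real.pi * I / 2) * (exp (2 * (Real.pi : ℂ) * I * (s / 4))
      + (δ : ℂ) * exp (2 * (Real.pi : ℂ) * I * (-(s / 4)))) / trigFactor δ s + Real.pi * I / 2
      = Real.pi * I * exp (2 * (Real.pi : ℂ) * I * (s / 4)) / trigFactor δ s := by
    rw [div_add' _ _ _ hne]
    congr 1
    unfold trigFactor
    ring
  rw [e, norm_div, norm_mul, norm_mul, norm_I, norm_real, norm_exp_quarter,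
    Real.norm_of_nonneg Real.pi_pos.le, mul_one]
  set a := Real.exp (-(Real.pi / 2) * s.im)
  set b := Real.exp (Real.pi / 2 * s.im)
  have hab : a * b = 1 := by simp only [a, b]; rw [← Real.exp_add]; simp
  have ha : 0 < a := Real.exp_pos _
  have hlow : b - a ≤ ‖trigFactor δ s‖ := by
    have := norm_sub_norm_le ((δ : ℂ) * exp (2 * (Real.pi : ℂ) * I * (-(s / 4))))
      (exp (2 * (Real.pi : ℂ) * I * (s / 4)))
    rw [norm_mul, norm_delta hδ, one_mul, norm_exp_neg_quarter, norm_exp_quarter,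
      norm_sub_rev] at this
    exact this
  have hb : 1 + Real.pi / 2 * s.im + (Real.pi / 2 * s.im) ^ 2 / 2 ≤ b :=
    Real.quadratic_le_exp_of_nonneg (by positivity)
  have hpi := Real.pi_gt_three
  have hpi4 := Real.pi_le_four
  have hx : 3 / 2 * s.im ≤ Real.pi / 2 * s.im := by nlinarith
  have hb2 : 1 + 2 * s.im ≤ b := by nlinarith
  have hb3 : 2 * a * s.im ≤ 1 - a := by nlinarith
  rw [div_le_div_iff₀ (by nlinarith) (by linarith)]
  nlinarith

/-- The subtracted term is `log (-it)`. The horizontal segment from `-it` to `1 - s` is shorter than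
one, and `|1/z| ≤ 1/t` on it. -/
lemma norm_log_one_sub_sub_le {s : ℂ} (h0 : 0 < s.re) (h1 : s.re < 1) (hs : 1 ≤ s.im) :
    ‖log (1 - s) - (Real.log s.im - Real.pi * I / 2)‖ ≤ 1 / s.im := by
  have hs0 : 0 < s.im := by linarith
  set w : ℂ := -(s.im : ℂ) * I
  have hlog : log w = Real.log s.im - Real.pi * I / 2 := by
    have : w = (s.im : ℂ) * (-I) := by simp [w]
    rw [this, log_ofReal_mul hs0 (by simp), log_neg_I]
    ring
  have key := norm_image_sub_le_of_norm_deriv_le_segment_01'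
    (f := fun u : ℝ => log (u * (1 - s.re : ℝ) + w))
    (f' := fun u => (1 - s.re : ℝ) / (u * (1 - s.re : ℝ) + w))
    (C := 1 / s.im) ?_ ?_
  · have e : (1 : ℂ) - s = (1 - s.re : ℝ) + w := by
      apply Complex.ext <;> simp [w]
    rw [e, ← hlog]
    simpa using key
  · intro u _
    refine HasDerivAt.hasDerivWithinAt ?_
    have : HasDerivAt (fun u : ℝ => (u : ℂ) * (1 - s.re : ℝ) + w) ((1 - s.re : ℝ) : ℂ) u := by
      simpa using (((hasDerivAt_id u).ofReal_comp).mul_const ((1 - s.re : ℝ) : ℂ)).add_const w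
    exact this.clog_real (Or.inr (by simp [w]; linarith))
  · intro u _
    rw [norm_div, norm_real, Real.norm_of_nonneg (by linarith)]
    have h2 := abs_im_le_norm ((u : ℂ) * (1 - s.re : ℝ) + w)
    have h3 : ((u : ℂ) * (1 - s.re : ℝ) + w).im = -s.im := by simp [w]
    rw [h3, abs_neg, abs_of_pos hs0] at h2
    have : 1 - s.re ≤ 1 := by linarith
    gcongr

lemma logDeriv_eq (hq : 0 < q) (hδ : δ = 1 ∨ δ = -1) {s : ℂ} (hs : s.im ≠ 0) :
    logDeriv (DeltaFactor q δ) s = -Real.log (q / (2 * Real.pi)) - digamma (1 - s)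
      + logDeriv (trigFactor δ) s := by
  have hpos : (0 : ℝ) < q / (2 * Real.pi) := by positivity
  have hb : ((q : ℂ) / (2 * (Real.pi : ℂ))) ^ (1 - s) ≠ 0 := by
    simp [cpow_eq_zero_iff, base_ne_zero hq]
  have hG := Gamma_ne_zero (one_sub_ne_neg_natCast hs)
  have e : DeltaFactor q δ = fun s => (-I * ((q : ℂ) / (2 * (Real.pi : ℂ))) ^ (1 - s)
      * (Gamma (1 - s) / ((Real.sqrt (q : ℝ) : ℝ) : ℂ))) * trigFactor δ s := rfl
  have hsub : HasDerivAt (fun s : ℂ => 1 - s) (-1) s := by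
    simpa using (hasDerivAt_id s).const_sub 1
  rw [e, logDeriv_mul (f := fun s => -I * ((q : ℂ) / (2 * (Real.pi : ℂ))) ^ (1 - s)
      * (Gamma (1 - s) / ((Real.sqrt (q : ℝ) : ℝ) : ℂ))) (g := trigFactor δ) s
      (mul_ne_zero (mul_ne_zero (neg_ne_zero.2 I_ne_zero) hb) (div_ne_zero hG (sqrt_ne_zero hq)))
      (trigFactor_ne_zero hδ hs) (((differentiable_base hq s).const_mul _).mul
      ((differentiableAt_Gamma_one_sub hs).div_const _)) (differentiable_trigFactor δ s),
    logDeriv_mul (f := fun s => -I * ((q : ℂ) / (2 * (Real.pi : ℂ))) ^ (1 - s))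
      (g := fun s => Gamma (1 - s) / ((Real.sqrt (q : ℝ) : ℝ) : ℂ)) s
      (mul_ne_zero (neg_ne_zero.2 I_ne_zero) hb) (div_ne_zero hG (sqrt_ne_zero hq))
      ((differentiable_base hq s).const_mul _) ((differentiableAt_Gamma_one_sub hs).div_const _)]
  rw [sub_eq_add_neg]
  congr 2
  · rw [logDeriv_const_mul _ _ (neg_ne_zero.2 I_ne_zero), logDeriv_apply,
      (hsub.const_cpow (Or.inl (base_ne_zero hq))).deriv, base_eq, ofReal_log hpos.le]
    rw [base_eq] at hb
    field_simp
  · simp only [div_eq_mul_inv (Gamma _)]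
    rw [logDeriv_mul_const _ _ (inv_ne_zero (sqrt_ne_zero hq)), logDeriv_apply,
      (show HasDerivAt (fun s => Gamma (1 - s)) _ s from
        ((differentiableAt_Gamma _ (one_sub_ne_neg_natCast hs)).hasDerivAt).comp s hsub).deriv,
      digamma_def, logDeriv_apply]
    ring

/-- The logarithmic derivative of `Δ` in the upper half of the critical strip. -/
lemma norm_logDeriv_add_log_le (hq : 0 < q) (hδ : δ = 1 ∨ δ = -1) {s : ℂ} (h0 : 0 < s.re)
    (h1 : s.re < 1) (hs : 1 ≤ s.im) :
    ‖logDeriv (DeltaFactor q δ) s + Real.log (q / (2 * Real.pi) * s.im)‖ ≤ 7 / s.im := by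
  have hpos : (0 : ℝ) < q / (2 * Real.pi) := by positivity
  have hs0 : 0 < s.im := by linarith
  have ha := norm_digamma_sub_log_le (z := 1 - s) (by simpa using h1)
    (by simpa [abs_of_pos hs0] using hs)
  have him : |(1 - s).im| = s.im := by simp [abs_of_pos hs0]
  rw [him] at ha
  have hb := norm_log_one_sub_sub_le h0 h1 hs
  have hc := norm_logDeriv_trigFactor_add_le hδ hs
  rw [logDeriv_eq hq hδ hs0.ne', Real.log_mul hpos.ne' hs0.ne']
  -- The imaginary constants `πi/2` from `-log (1 - s)` and `-πi/2` from the trigonometric factor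
  -- cancel. The three remaining errors add up to `(2 + 4 + 1) / t`.
  have e : (-Real.log (q / (2 * Real.pi)) - digamma (1 - s) + logDeriv (trigFactor δ) s
      + ((Real.log (q / (2 * Real.pi)) + Real.log s.im : ℝ) : ℂ) : ℂ)
      = (logDeriv (trigFactor δ) s + Real.pi * I / 2) - (digamma (1 - s) - log (1 - s))
        - (log (1 - s) - (Real.log s.im - Real.pi * I / 2)) := by
    push_cast; ring
  rw [e]
  refine (norm_sub_le _ _).trans ((add_le_add (norm_sub_le _ _) le_rfl).trans ?_)
  have : 7 / s.im = 2 / s.im + 4 / s.im + 1 / s.im := by ring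
  linarith

/-- `Δ` has a holomorphic logarithm in the upper half plane. -/
lemma exists_eq_exp_neg (hq : 0 < q) (hδ : δ = 1 ∨ δ = -1) :
    ∃ G : ℂ → ℂ, ∀ s : ℂ, 0 < s.im → HasDerivAt G (-logDeriv (DeltaFactor q δ) s) s ∧
      DeltaFactor q δ s = exp (-G s) := by
  have hopen : IsOpen {s : ℂ | 0 < s.im} := isOpen_lt continuous_const continuous_im
  have hconv : Convex ℝ {s : ℂ | 0 < s.im} := convex_halfSpace_im_gt 0
  have hd : DifferentiableOn ℂ (DeltaFactor q δ) {s : ℂ | 0 < s.im} := fun s hs =>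
    (differentiableAt hq (ne_of_gt hs)).differentiableWithinAt
  have hL : DifferentiableOn ℂ (fun s => -logDeriv (DeltaFactor q δ) s) {s : ℂ | 0 < s.im} :=
    ((hd.deriv hopen).div hd fun s hs => ne_zero hq hδ (ne_of_gt hs)).neg
  obtain ⟨g, hg⟩ := hconv.exists_forall_hasDerivWithinAt hL
  have hg' : ∀ s : ℂ, 0 < s.im → HasDerivAt g (-logDeriv (DeltaFactor q δ) s) s := fun s hs =>
    (hg s hs).hasDerivAt (hopen.mem_nhds hs)
  have hconst : ∀ s : ℂ, 0 < s.im →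
      DeltaFactor q δ s * exp (g s) = DeltaFactor q δ I * exp (g I) := by
    intro s hs
    refine hopen.is_const_of_deriv_eq_zero hconv.isPreconnected (𝕜 := ℂ) (f := fun s => DeltaFactor q δ s * exp (g s)) ?_ ?_ hs (by simp)
    · intro z hz
      exact ((differentiableAt hq (ne_of_gt hz)).mul
        (hg' z hz).differentiableAt.cexp).differentiableWithinAt
    · intro z hz
      have hz0 := ne_zero (q := q) hq hδ (ne_of_gt hz)
      rw [(show HasDerivAt (fun s => DeltaFactor q δ s * exp (g s)) _ z from
        ((differentiableAt hq (ne_of_gt hz)).hasDerivAt).mul (hg' z hz).cexp).deriv,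
        logDeriv_apply]
      simp only [Pi.zero_apply]
      field_simp
      ring
  have hc : DeltaFactor q δ I * exp (g I) ≠ 0 :=
    mul_ne_zero (ne_zero hq hδ (by simp)) (exp_ne_zero _)
  -- The primitive is shifted by a logarithm of the constant value of `Δ exp g`.
  refine ⟨fun s => g s - log (DeltaFactor q δ I * exp (g I)), fun s hs => ⟨?_, ?_⟩⟩
  · simpa using (hg' s hs).sub_const (log (DeltaFactor q δ I * exp (g I)))
  · rw [neg_sub, exp_sub, exp_log hc, ← hconst s hs, mul_div_cancel_right₀ _ (exp_ne_zero _)]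

end DeltaFactor

/-! ### Level curves of the phase in the critical strip -/

/-- `G` is holomorphic in the upper half plane, has vanishing real part on the critical line, and
`G'(σ + it) = log (κ t) + O(1 / t)` in the critical strip. -/
structure IsCriticalPhase (G : ℂ → ℂ) (κ C : ℝ) : Prop where
  pos : 0 < κ
  differentiableAt : ∀ s : ℂ, 0 < s.im → DifferentiableAt ℂ G s
  norm_deriv_sub_le : ∀ s : ℂ, 0 < s.re → s.re < 1 → 1 ≤ s.im →
    ‖deriv G s - Real.log (κ * s.im)‖ ≤ C / s.im
  re_eq_zero : ∀ t : ℝ, 0 < t → (G (1 / 2 + t * Complex.I)).re = 0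

open Complex

/-- A difference quotient of a holomorphic function lies in every closed convex set which contains
the values of the derivative on the segment. -/
lemma exists_mem_sub_eq_mul_of_segment {G : ℂ → ℂ} {U K : Set ℂ} (hU : IsOpen U)
    (hG : DifferentiableOn ℂ G U) (hK : Convex ℝ K) (hKc : IsClosed K) {s s' : ℂ}
    (hsU : segment ℝ s s' ⊆ U) (hmem : ∀ z ∈ segment ℝ s s', deriv G z ∈ K) :
    ∃ w ∈ K, G s' - G s = w * (s' - s) := by
  have hseg : ∀ u ∈ Set.Icc (0 : ℝ) 1, s + u * (s' - s) ∈ segment ℝ s s' := fun u hu => by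
    rw [segment_eq_image']
    exact ⟨u, hu, by simp⟩
  have hline : Continuous fun u : ℝ => s + u * (s' - s) := by fun_prop
  have hcont : ContinuousOn (fun u : ℝ => deriv G (s + u * (s' - s))) (Set.Icc 0 1) :=
    (hG.deriv hU).continuousOn.comp hline.continuousOn fun u hu => hsU (hseg u hu)
  let μ : MeasureTheory.Measure ℝ := MeasureTheory.volume.restrict (Set.Ioc 0 1)
  have hμ : MeasureTheory.IsProbabilityMeasure μ := ⟨by simp [μ]⟩
  refine ⟨∫ u in (0 : ℝ)..1, deriv G (s + u * (s' - s)), ?_, ?_⟩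
  · rw [intervalIntegral.integral_of_le zero_le_one]
    refine Convex.integral_mem (μ := μ) hK hKc ?_ ?_
    · refine (MeasureTheory.ae_restrict_mem measurableSet_Ioc).mono fun u hu => ?_
      exact hmem _ (hseg u ⟨hu.1.le, hu.2⟩)
    · exact (hcont.integrableOn_compact isCompact_Icc).mono_set Set.Ioc_subset_Icc_self
  · rw [← intervalIntegral.integral_mul_const]
    have h := intervalIntegral.integral_eq_sub_of_hasDerivAt (a := 0) (b := 1)
      (f := fun u : ℝ => G (s + u * (s' - s)))
      (f' := fun u : ℝ => deriv G (s + u * (s' - s)) * (s' - s)) ?_ ?_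
    · rw [h]; simp
    · intro u hu
      rw [Set.uIcc_of_le zero_le_one] at hu
      have h1 : HasDerivAt (fun u : ℝ => s + u * (s' - s)) (s' - s) u := by
        simpa using (((hasDerivAt_id u).ofReal_comp).mul_const (s' - s)).const_add s
      exact ((hG.differentiableAt (hU.mem_nhds (hsU (hseg u hu)))).hasDerivAt).comp u h1
    · refine ContinuousOn.intervalIntegrable ?_
      rw [Set.uIcc_of_le zero_le_one]
      exact hcont.mul continuousOn_const

/-- The part of the open critical strip on and above the horizontal line of height `t₀`. -/
def upperStrip (t₀ : ℝ) : Set ℂ := {s | 0 < s.re ∧ s.re < 1 ∧ t₀ ≤ s.im}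

lemma convex_upperStrip (t₀ : ℝ) : Convex ℝ (upperStrip t₀) :=
  (convex_halfSpace_re_gt 0).inter ((convex_halfSpace_re_lt 1).inter (convex_halfSpace_im_ge t₀))

namespace IsCriticalPhase

variable {G : ℂ → ℂ} {κ C : ℝ}

/-- Above this height the error `C / t` is at most one while the logarithm is at least two, so `Re
G' ≥ 1 ≥ |Im G'|`. -/
lemma exists_height (hG : IsCriticalPhase G κ C) :
    ∃ t₀ : ℝ, 1 ≤ t₀ ∧ (∀ t, t₀ ≤ t → 2 ≤ Real.log (κ * t)) ∧ ∀ s ∈ upperStrip t₀,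
      |(deriv G s).re - Real.log (κ * s.im)| ≤ 1 ∧ |(deriv G s).im| ≤ 1 := by
  refine ⟨max 1 (max C (Real.exp 2 / κ)), le_max_left _ _, ?_, ?_⟩
  · intro t ht
    have h1 : Real.exp 2 / κ ≤ t := (le_max_right _ _).trans ((le_max_right _ _).trans ht)
    rw [div_le_iff₀ hG.pos, mul_comm] at h1
    rwa [Real.le_log_iff_exp_le ((Real.exp_pos 2).trans_le h1)]
  · rintro s ⟨h0, h1, hs⟩
    have hs1 : 1 ≤ s.im := (le_max_left _ _).trans hs
    have hC : C ≤ s.im := (le_max_left _ _).trans ((le_max_right _ _).trans hs)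
    have h2 : ‖deriv G s - Real.log (κ * s.im)‖ ≤ 1 :=
      (hG.norm_deriv_sub_le s h0 h1 hs1).trans ((div_le_one (by linarith)).2 hC)
    constructor
    · simpa using (abs_re_le_norm _).trans h2
    · have := (abs_im_le_norm _).trans h2
      rwa [sub_im, ofReal_im, sub_zero] at this

/-- Since the logarithm is monotone, on `a ≤ t ≤ b` the derivative takes values in one closed
rectangle, which is convex and so contains the difference quotient `w`. -/
lemma exists_average (hG : IsCriticalPhase G κ C) {t₀ : ℝ} (h1 : 1 ≤ t₀)
    (hder : ∀ s ∈ upperStrip t₀,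
      |(deriv G s).re - Real.log (κ * s.im)| ≤ 1 ∧ |(deriv G s).im| ≤ 1)
    {a b : ℝ} (ha : t₀ ≤ a) {s s' : ℂ} (hs : s ∈ upperStrip a) (hs' : s' ∈ upperStrip a)
    (hb : s.im ≤ b) (hb' : s'.im ≤ b) :
    ∃ w : ℂ, Real.log (κ * a) - 1 ≤ w.re ∧ w.re ≤ Real.log (κ * b) + 1 ∧ |w.im| ≤ 1 ∧
      G s' - G s = w * (s' - s) := by
  have hκ := hG.pos
  have hopen : IsOpen {s : ℂ | 0 < s.im} := isOpen_lt continuous_const continuous_im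
  have hK : {w : ℂ | Real.log (κ * a) - 1 ≤ w.re ∧ w.re ≤ Real.log (κ * b) + 1 ∧ |w.im| ≤ 1}
      = {w : ℂ | Real.log (κ * a) - 1 ≤ w.re} ∩ ({w : ℂ | w.re ≤ Real.log (κ * b) + 1} ∩
        ({w : ℂ | -1 ≤ w.im} ∩ {w : ℂ | w.im ≤ 1})) := by
    ext w; simp [abs_le]
  have hconv : Convex ℝ (upperStrip a ∩ {z : ℂ | z.im ≤ b}) :=
    (convex_upperStrip a).inter (convex_halfSpace_im_le b)
  have hsub : segment ℝ s s' ⊆ upperStrip a ∩ {z : ℂ | z.im ≤ b} :=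
    hconv.segment_subset ⟨hs, hb⟩ ⟨hs', hb'⟩
  obtain ⟨w, ⟨hw1, hw2, hw3⟩, hw4⟩ := exists_mem_sub_eq_mul_of_segment hopen
    (fun z hz => (hG.differentiableAt z hz).differentiableWithinAt)
    (K := {w : ℂ | Real.log (κ * a) - 1 ≤ w.re ∧ w.re ≤ Real.log (κ * b) + 1 ∧ |w.im| ≤ 1})
    (by
      rw [hK]
      exact (convex_halfSpace_re_ge _).inter ((convex_halfSpace_re_le _).inter
        ((convex_halfSpace_im_ge _).inter (convex_halfSpace_im_le _))))
    (by
      rw [hK]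
      exact (isClosed_le continuous_const continuous_re).inter
        ((isClosed_le continuous_re continuous_const).inter
        ((isClosed_le continuous_const continuous_im).inter
          (isClosed_le continuous_im continuous_const))))
    (s := s) (s' := s')
    (fun z hz => by
      have h := (hsub hz).1.2.2
      show 0 < z.im
      linarith)
    (fun z hz => by
      obtain ⟨⟨hz0, hz1, hza⟩, hzb⟩ := hsub hz
      have hzb : z.im ≤ b := hzb
      obtain ⟨h2, h3⟩ := hder z ⟨hz0, hz1, ha.trans hza⟩
      have hapos : 0 < κ * a := mul_pos hκ (by linarith)
      have hlo : Real.log (κ * a) ≤ Real.log (κ * z.im) :=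
        Real.log_le_log hapos (by gcongr)
      have hhi : Real.log (κ * z.im) ≤ Real.log (κ * b) :=
        Real.log_le_log (mul_pos hκ (by linarith)) (by gcongr)
      rw [abs_le] at h2
      exact ⟨by linarith, by linarith, h3⟩)
  exact ⟨w, hw1, hw2, hw3, hw4⟩

/-- On a level curve of `Re G`, the imaginary part of `G` increases with the height. -/
lemma level_estimate (hG : IsCriticalPhase G κ C) {t₀ : ℝ} (h1 : 1 ≤ t₀)
    (hlog : ∀ t, t₀ ≤ t → 2 ≤ Real.log (κ * t))
    (hder : ∀ s ∈ upperStrip t₀,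
      |(deriv G s).re - Real.log (κ * s.im)| ≤ 1 ∧ |(deriv G s).im| ≤ 1)
    {s s' : ℂ} (hs : s ∈ upperStrip t₀) (hs' : s' ∈ upperStrip t₀) (hle : s.im ≤ s'.im)
    (hre : (G s).re = (G s').re) :
    s'.im - s.im ≤ (G s').im - (G s).im ∧
      (G s').im - (G s).im ≤ (Real.log (κ * s'.im) + 2) * (s'.im - s.im) ∧
      |s'.re - s.re| ≤ s'.im - s.im := by
  obtain ⟨w, hw1, hw2, hw3, hw⟩ := hG.exists_average h1 hder le_rfl hs hs' hle le_rfl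
  have hw1' : 1 ≤ w.re := by linarith [hlog t₀ le_rfl]
  have hr := congrArg re hw
  have hi := congrArg im hw
  simp only [sub_re, mul_re, sub_im, mul_im] at hr hi
  set dx := s'.re - s.re
  set dy := s'.im - s.im
  have hdy : 0 ≤ dy := sub_nonneg.2 hle
  set D := (G s').im - (G s).im
  -- Equal real parts fix `dx` in terms of `dy`; eliminating `dx` gives `Re w · D = |w|² dy`, and
  -- all three estimates follow from `Re w ≥ 1 ≥ |Im w|`.
  have e1 : w.re * dx = w.im * dy := by linarith
  have e2 : w.re * D = (w.re ^ 2 + w.im ^ 2) * dy := by rw [hi]; linear_combination w.im * e1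
  have hw3' : w.im ^ 2 ≤ 1 := by rw [← sq_abs]; exact pow_le_one₀ (abs_nonneg _) hw3
  refine ⟨?_, ?_, ?_⟩
  · have : w.re * dy ≤ w.re * D := by
      rw [e2]
      refine mul_le_mul_of_nonneg_right ?_ hdy
      nlinarith [sq_nonneg w.im]
    exact le_of_mul_le_mul_left this (by linarith)
  · have h3 : w.re * D ≤ w.re * ((w.re + 1) * dy) := by
      rw [e2, ← mul_assoc]
      refine mul_le_mul_of_nonneg_right ?_ hdy
      nlinarith
    have h4 := le_of_mul_le_mul_left h3 (by linarith)
    refine h4.trans (mul_le_mul_of_nonneg_right (by linarith) hdy)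
  · have h3 : w.re * |dx| ≤ w.re * dy := by
      have := congrArg abs e1
      rw [abs_mul, abs_mul, abs_of_nonneg hdy, abs_of_pos (by linarith : 0 < w.re)] at this
      rw [this]
      exact mul_le_mul_of_nonneg_right (hw3.trans hw1') hdy
    exact le_of_mul_le_mul_left h3 (by linarith)

/-- On a horizontal segment `Re G` vanishes at the midpoint and its chords from there have slope at
least `log (κt) - 1`, so the intermediate value theorem applies. -/
lemma exists_level_point (hG : IsCriticalPhase G κ C) {t₀ : ℝ} (h1 : 1 ≤ t₀)
    (hder : ∀ s ∈ upperStrip t₀,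
      |(deriv G s).re - Real.log (κ * s.im)| ≤ 1 ∧ |(deriv G s).im| ≤ 1)
    (c : ℝ) {η t : ℝ} (h0 : 0 < η) (hη : η < 1 / 2) (ht : t₀ ≤ t)
    (hc : |c| ≤ η * (Real.log (κ * t) - 1)) :
    ∃ s : ℂ, s.im = t ∧ |s.re - 1 / 2| ≤ η ∧ (G s).re = c := by
  have hmem : ∀ x ∈ Set.Icc (1 / 2 - η) (1 / 2 + η), (x + t * I : ℂ) ∈ upperStrip t := by
    intro x hx
    refine ⟨?_, ?_, ?_⟩ <;> simp <;> linarith [hx.1, hx.2]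
  have hcont : ContinuousOn (fun x : ℝ => (G (x + t * I)).re)
      (Set.Icc (1 / 2 - η) (1 / 2 + η)) := by
    intro x hx
    refine ContinuousAt.continuousWithinAt ?_
    refine continuous_re.continuousAt.comp ?_
    refine ContinuousAt.comp (g := G) ?_ (by fun_prop)
    exact (hG.differentiableAt _ (by simp; linarith)).continuousAt
  have hmid := hG.re_eq_zero t (by linarith)
  have hhalf : (1 / 2 + t * I : ℂ) = ((1 / 2 : ℝ) : ℂ) + t * I := by push_cast; ring
  rw [hhalf] at hmid
  have key : ∀ x ∈ Set.Icc (1 / 2 - η) (1 / 2 + η), ∃ w : ℝ, Real.log (κ * t) - 1 ≤ w ∧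
      (G (x + t * I)).re = w * (x - 1 / 2) := by
    intro x hx
    obtain ⟨w, hw1, -, -, hw⟩ := hG.exists_average h1 hder ht
      (hmem (1 / 2) ⟨by linarith, by linarith⟩) (hmem x hx) (b := t) (by simp) (by simp)
    have hr := congrArg re hw
    refine ⟨w.re, hw1, ?_⟩
    simp only [sub_re, mul_re, hmid, add_re, ofReal_re, I_re, ofReal_im, I_im, sub_im, add_im,
      mul_im] at hr
    linarith
  have hab : (1 / 2 - η) ≤ 1 / 2 + η := by linarith
  obtain ⟨w1, hw1, e1⟩ := key (1 / 2 - η) ⟨le_rfl, hab⟩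
  obtain ⟨w2, hw2, e2⟩ := key (1 / 2 + η) ⟨hab, le_rfl⟩
  rw [abs_le] at hc
  obtain ⟨x, hx, hxc⟩ := intermediate_value_Icc hab hcont (show c ∈ Set.Icc _ _ from by
    constructor
    · simp only [e1]; nlinarith
    · simp only [e2]; nlinarith)
  refine ⟨x + t * I, by simp, ?_, hxc⟩
  simp only [add_re, ofReal_re, mul_re, I_re, ofReal_im, I_im]
  rw [abs_le]
  constructor <;> linarith [hx.1, hx.2]

lemma eventually_level_bound (hκ : 0 < κ) (c : ℝ) {η : ℝ} (h0 : 0 < η) :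
    ∀ᶠ t : ℝ in atTop, |c| ≤ η * (Real.log (κ * t) - 1) := by
  have h : Tendsto (fun t : ℝ => η * (Real.log (κ * t) - 1)) atTop atTop :=
    (tendsto_atTop_add_const_right _ (-1)
      (Real.tendsto_log_atTop.comp (tendsto_id.const_mul_atTop hκ))).const_mul_atTop h0
  exact h.eventually_ge_atTop _

/-- The level curve `Re G = c` is, from some height on, a graph over the critical line, on which
`Im G` is strictly increasing and continuous. -/
lemma exists_level_curve (hG : IsCriticalPhase G κ C) (c : ℝ) {η : ℝ} (h0 : 0 < η)
    (hη : η < 1 / 2) :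
    ∃ t₁ : ℝ, 1 ≤ t₁ ∧ ∃ p : ℝ → ℂ,
      (∀ t, t₁ ≤ t → (p t).im = t ∧ |(p t).re - 1 / 2| ≤ η ∧ (G (p t)).re = c) ∧
      (∀ s ∈ upperStrip t₁, (G s).re = c → s = p s.im) ∧
      ContinuousOn (fun t => (G (p t)).im) (Set.Ici t₁) ∧
      (∀ t t', t₁ ≤ t → t ≤ t' → t' - t ≤ (G (p t')).im - (G (p t)).im) ∧
      (∀ s ∈ upperStrip t₁, 1 ≤ (deriv G s).re) ∧
      ∀ t, t₁ ≤ t → |(G (p t)).im - (G (1 / 2 + t * I)).im| ≤ 1 := by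
  obtain ⟨t₀, h1, hlog, hder⟩ := hG.exists_height
  obtain ⟨t₂, ht₂⟩ := eventually_atTop.1 (eventually_level_bound hG.pos c h0)
  set t₁ := max t₀ t₂
  have h01 : t₀ ≤ t₁ := le_max_left _ _
  have hex : ∀ t, ∃ s : ℂ, t₁ ≤ t → s.im = t ∧ |s.re - 1 / 2| ≤ η ∧ (G s).re = c := by
    intro t
    by_cases ht : t₁ ≤ t
    · obtain ⟨s, hs⟩ := hG.exists_level_point h1 hder c h0 hη (h01.trans ht)
        (ht₂ t ((le_max_right _ _).trans ht))
      exact ⟨s, fun _ => hs⟩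
    · exact ⟨0, fun h => absurd h ht⟩
  choose p hp using hex
  have hpm : ∀ t, t₁ ≤ t → p t ∈ upperStrip t₁ := by
    intro t ht
    obtain ⟨h2, h3, -⟩ := hp t ht
    rw [abs_le] at h3
    exact ⟨by linarith, by linarith, by rw [h2]; exact ht⟩
  have hmono : ∀ {s}, s ∈ upperStrip t₁ → s ∈ upperStrip t₀ := fun hs => ⟨hs.1, hs.2.1, h01.trans hs.2.2⟩
  have hest : ∀ t t', t₁ ≤ t → t ≤ t' → t' - t ≤ (G (p t')).im - (G (p t)).im ∧
      (G (p t')).im - (G (p t)).im ≤ (Real.log (κ * t') + 2) * (t' - t) := by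
    intro t t' ht htt
    have h := hG.level_estimate h1 hlog hder (hmono (hpm t ht)) (hmono (hpm t' (ht.trans htt)))
      (by rw [(hp t ht).1, (hp t' (ht.trans htt)).1]; exact htt)
      ((hp t ht).2.2.trans (hp t' (ht.trans htt)).2.2.symm)
    rw [(hp t ht).1, (hp t' (ht.trans htt)).1] at h
    exact ⟨h.1, h.2.1⟩
  refine ⟨t₁, h1.trans h01, p, hp, ?_, ?_, fun t t' ht htt => (hest t t' ht htt).1, ?_, ?_⟩
  · intro s hs hsc
    have him := hs.2.2
    have h := hG.level_estimate h1 hlog hder (hmono hs) (hmono (hpm s.im him))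
      (by rw [(hp s.im him).1]) (hsc.trans (hp s.im him).2.2.symm)
    rw [(hp s.im him).1, sub_self] at h
    have h3 := abs_nonpos_iff.1 h.2.2
    exact Complex.ext (by linarith) (hp s.im him).1.symm
  -- The upper estimate makes `Im G` Lipschitz along the curve on bounded ranges; the constant grows
  -- with the height.
  · have hloc : ∀ b, LipschitzOnWith (Real.log (κ * b) + 2).toNNReal (fun t => (G (p t)).im)
        (Set.Icc t₁ b) := by
      intro b
      refine LipschitzOnWith.of_le_add_mul _ fun x hx y hy => ?_
      have hb : 0 ≤ Real.log (κ * b) + 2 := by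
        linarith [hlog b (h01.trans (hx.1.trans hx.2))]
      rw [Real.coe_toNNReal _ hb, Real.dist_eq]
      rcases le_total x y with hxy | hxy
      · have := (hest x y hx.1 hxy).1
        have : 0 ≤ (Real.log (κ * b) + 2) * |x - y| := by positivity
        linarith
      · have h := (hest y x hy.1 hxy).2
        rw [abs_of_nonneg (sub_nonneg.2 hxy)]
        have hx0 : 0 < x := by linarith [hx.1]
        have : Real.log (κ * x) ≤ Real.log (κ * b) :=
          Real.log_le_log (mul_pos hG.pos hx0) (mul_le_mul_of_nonneg_left hx.2 hG.pos.le)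
        nlinarith [mul_le_mul_of_nonneg_right this (sub_nonneg.2 hxy)]
    intro t ht
    have h2 := (hloc (t + 1)).continuousOn t ⟨ht, by linarith⟩
    refine h2.mono_of_mem_nhdsWithin ?_
    have : Set.Iio (t + 1) ∈ 𝓝 t := Iio_mem_nhds (by linarith)
    filter_upwards [self_mem_nhdsWithin, mem_nhdsWithin_of_mem_nhds this] with x hx hx'
    exact ⟨hx, le_of_lt hx'⟩
  · intro s hs
    have h2 := (hder s (hmono hs)).1
    rw [abs_le] at h2
    linarith [hlog s.im (h01.trans hs.2.2)]
  · intro t ht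
    have hhalf : (1 / 2 + t * I : ℂ) ∈ upperStrip t₁ := by
      refine ⟨?_, ?_, ?_⟩ <;> simp <;> norm_num
      exact ht
    obtain ⟨w, -, -, hw3, hw⟩ := hG.exists_average h1 hder h01 hhalf (hpm t ht) (b := t)
      (by simp) (by rw [(hp t ht).1])
    have hi := congrArg im hw
    simp only [sub_im, mul_im, (hp t ht).1, sub_re] at hi
    simp at hi
    rw [one_div, hi, abs_mul]
    have h3 : |(p t).re - 2⁻¹| ≤ 1 := by
      have := (hp t ht).2.1
      rw [one_div] at this
      linarith
    exact mul_le_one₀ hw3 (abs_nonneg _) h3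

/-- The variation of the phase along the critical line. -/
lemma im_half_estimate (hG : IsCriticalPhase G κ C) {T : ℝ} (hT : 1 ≤ T) :
    |(G (1 / 2 + T * I)).im - (T * Real.log (κ * T) - T)|
      ≤ C * Real.log T + |(G (1 / 2 + (1 : ℝ) * I)).im - (Real.log κ - 1)| := by
  have hκ := hG.pos
  have hd : ∀ t : ℝ, 1 ≤ t → HasDerivAt
      (fun t : ℝ => (G (1 / 2 + t * I)).im - (t * Real.log (κ * t) - t))
      ((deriv G (1 / 2 + t * I)).re - Real.log (κ * t)) t := by
    intro t ht
    have ht0 : 0 < t := by linarith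
    have h1 : HasDerivAt (fun t : ℝ => (1 / 2 + t * I : ℂ)) I t := by
      simpa using (((hasDerivAt_id t).ofReal_comp).mul_const I).const_add (1 / 2 : ℂ)
    have h2 := ((hG.differentiableAt (1 / 2 + t * I) (by simpa using ht0)).hasDerivAt).comp t h1
    have h3 : HasDerivAt (fun t : ℝ => (G (1 / 2 + t * I)).im)
        ((deriv G (1 / 2 + t * I)) * I).im t :=
      (imCLM.hasFDerivAt.comp_hasDerivAt t h2)
    have h4 : HasDerivAt (fun t : ℝ => t * Real.log (κ * t) - t)
        (1 * Real.log (κ * t) + t * (κ * 1 / (κ * t)) - 1) t :=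
      ((hasDerivAt_id t).mul (((hasDerivAt_id t).const_mul κ).log (by positivity))).sub
        (hasDerivAt_id t)
    refine (h3.sub h4).congr_deriv ?_
    simp
    field_simp
    ring
  have hB : ∀ t : ℝ, 1 ≤ t → HasDerivAt (fun t : ℝ => C * Real.log t +
      |(G (1 / 2 + (1 : ℝ) * I)).im - (Real.log κ - 1)|) (C / t) t := by
    intro t ht
    have := ((Real.hasDerivAt_log (x := t) (by linarith)).const_mul C).add_const
      |(G (1 / 2 + (1 : ℝ) * I)).im - (Real.log κ - 1)|
    simpa [div_eq_mul_inv] using this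
  -- `t log (κt) - t` has derivative `log (κt)`, so the derivative of the difference is at most `C /
  -- t`, which integrates to `C log T`.
  have := image_norm_le_of_norm_deriv_right_le_deriv_boundary'
    (f := fun t : ℝ => (G (1 / 2 + t * I)).im - (t * Real.log (κ * t) - t))
    (f' := fun t : ℝ => (deriv G (1 / 2 + t * I)).re - Real.log (κ * t)) (a := 1) (b := T)
    (B := fun t : ℝ => C * Real.log t + |(G (1 / 2 + (1 : ℝ) * I)).im - (Real.log κ - 1)|)
    (B' := fun t => C / t)
    (fun t ht => (hd t ht.1).continuousAt.continuousWithinAt)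
    (fun t ht => (hd t ht.1).hasDerivWithinAt)
    (by simp)
    (fun t ht => (hB t ht.1).continuousAt.continuousWithinAt)
    (fun t ht => (hB t ht.1).hasDerivWithinAt)
    (fun t ht => by
      have h := hG.norm_deriv_sub_le (1 / 2 + t * I) (by simp) (by simp; norm_num)
        (by simpa using ht.1)
      have h' := (abs_re_le_norm _).trans h
      simpa using h')
    (x := T) ⟨hT, le_rfl⟩
  simpa using this

end IsCriticalPhase

/-! ### Counting a-points in the strip, and the Julia line -/

/-- The number of integers in an open interval. -/
lemma abs_ncard_int_Ioo_sub_le {x y : ℝ} (hxy : x ≤ y) :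
    |(({k : ℤ | x < k ∧ (k : ℝ) < y}.ncard : ℕ) : ℝ) - (y - x)| ≤ 1 := by
  have h : {k : ℤ | x < k ∧ (k : ℝ) < y} = ((Finset.Ioo ⌊x⌋ ⌈y⌉ : Finset ℤ) : Set ℤ) := by
    ext k
    simp [Int.floor_lt, Int.lt_ceil]
  rw [h, Set.ncard_coe_finset, Int.card_Ioo]
  have h1 := Int.floor_le x
  have h2 := Int.lt_floor_add_one x
  have h3 := Int.le_ceil y
  have h4 := Int.ceil_lt_add_one y
  -- `toNat` truncates only in the second case, which means that `x = y` is an integer.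
  rcases le_or_gt 0 (⌈y⌉ - ⌊x⌋ - 1) with h0 | h0
  · have h5 : (((⌈y⌉ - ⌊x⌋ - 1).toNat : ℕ) : ℝ) = ⌈y⌉ - ⌊x⌋ - 1 := by
      have : (((⌈y⌉ - ⌊x⌋ - 1).toNat : ℕ) : ℤ) = ⌈y⌉ - ⌊x⌋ - 1 := Int.toNat_of_nonneg h0
      exact_mod_cast this
    rw [h5, abs_le]
    constructor <;> linarith
  · rw [Int.toNat_of_nonpos h0.le]
    have h6 : ((⌈y⌉ - ⌊x⌋ - 1 : ℤ) : ℝ) ≤ -1 := by exact_mod_cast (by omega)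
    push_cast at h6 ⊢
    rw [abs_le]
    constructor <;> linarith

lemma exp_neg_eq_iff {a w : ℂ} (ha : a ≠ 0) :
    exp (-w) = a ↔ w.re = -Real.log ‖a‖ ∧ ∃ k : ℤ, w.im = -arg a + 2 * Real.pi * k := by
  constructor
  · intro h
    obtain ⟨n, hn⟩ := exp_eq_exp_iff_exists_int.1 (h.trans (exp_log ha).symm)
    have hr := congrArg re hn
    have hi := congrArg im hn
    simp [log_re, log_im] at hr hi
    refine ⟨by linarith, -n, ?_⟩
    push_cast
    linarith
  · rintro ⟨hr, k, hi⟩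
    rw [← exp_log ha]
    refine exp_eq_exp_iff_exists_int.2 ⟨-k, Complex.ext ?_ ?_⟩
    · simp [log_re, hr]
    · simp [log_im, hi]; ring

lemma isAPoint_iff_of_analyticAt {F : ℂ → ℂ} {s : ℂ} (h : AnalyticAt ℂ F s) (a : ℂ) :
    IsAPoint F a s ↔ F s = a := by
  have h1 : AnalyticAt ℂ (fun z => F z - a) s := h.sub analyticAt_const
  unfold IsAPoint
  rw [← tendsto_zero_iff_meromorphicOrderAt_pos h1.meromorphicAt]
  have h2 : Tendsto (fun z => F z - a) (𝓝[≠] s) (𝓝 (F s - a)) :=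
    h1.continuousAt.tendsto.mono_left nhdsWithin_le_nhds
  constructor
  · intro h3
    exact sub_eq_zero.1 (tendsto_nhds_unique h2 h3)
  · rintro rfl
    simpa using h2

namespace IsCriticalPhase

variable {F G : ℂ → ℂ} {κ C : ℝ}

lemma hasDerivAt_of_eq_exp (hG : IsCriticalPhase G κ C)
    (hexp : ∀ s : ℂ, 0 < s.im → F s = exp (-G s)) {s : ℂ} (hs : 0 < s.im) :
    HasDerivAt F (exp (-G s) * -deriv G s) s := by
  have h := ((hG.differentiableAt s hs).hasDerivAt.neg).cexp
  have hopen : IsOpen {s : ℂ | 0 < s.im} := isOpen_lt continuous_const continuous_im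
  refine h.congr_of_eventuallyEq ?_
  filter_upwards [hopen.mem_nhds hs] with z hz using hexp z hz

lemma analyticAt_of_eq_exp (hG : IsCriticalPhase G κ C)
    (hexp : ∀ s : ℂ, 0 < s.im → F s = exp (-G s)) {s : ℂ} (hs : 0 < s.im) :
    AnalyticAt ℂ F s := by
  have hopen : IsOpen {s : ℂ | 0 < s.im} := isOpen_lt continuous_const continuous_im
  have : DifferentiableOn ℂ F {s : ℂ | 0 < s.im} := fun z hz =>
    (hG.hasDerivAt_of_eq_exp hexp hz).differentiableAt.differentiableWithinAt
  exact this.analyticAt (hopen.mem_nhds hs)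

lemma isAPoint_iff (hG : IsCriticalPhase G κ C)
    (hexp : ∀ s : ℂ, 0 < s.im → F s = exp (-G s)) {s : ℂ} (hs : 0 < s.im) (a : ℂ) :
    IsAPoint F a s ↔ F s = a :=
  isAPoint_iff_of_analyticAt (hG.analyticAt_of_eq_exp hexp hs) a

lemma order_sub_eq_one (hG : IsCriticalPhase G κ C)
    (hexp : ∀ s : ℂ, 0 < s.im → F s = exp (-G s)) {s : ℂ} (hs : 0 < s.im)
    (hd : deriv G s ≠ 0) : meromorphicOrderAt (fun z => F z - F s) s = 1 := by
  have h := hG.analyticAt_of_eq_exp hexp hs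
  have h1 : AnalyticAt ℂ (fun z => F z - F s) s := h.sub analyticAt_const
  rw [h1.meromorphicOrderAt_eq, h.analyticOrderAt_sub_eq_one_of_deriv_ne_zero]
  · rfl
  · rw [(hG.hasDerivAt_of_eq_exp hexp hs).deriv]
    exact mul_ne_zero (exp_ne_zero _) (neg_ne_zero.2 hd)

lemma exists_deriv_ne_zero (hG : IsCriticalPhase G κ C) :
    ∃ s : ℂ, 0 < s.im ∧ deriv G s ≠ 0 := by
  obtain ⟨t₁, h1, -, -, -, -, -, hd, -⟩ := hG.exists_level_curve 0 (η := 1 / 4) (by norm_num)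
    (by norm_num)
  refine ⟨1 / 2 + t₁ * I, by simp; linarith, fun h => ?_⟩
  have := hd (1 / 2 + t₁ * I) ⟨by simp, by simp; norm_num, by simp⟩
  rw [h] at this
  norm_num at this

/-- By the identity theorem a finite order at one point suffices, and a point with `G' ≠ 0` provides
it. -/
lemma order_sub_ne_top (hG : IsCriticalPhase G κ C) (hF : Meromorphic F)
    (hexp : ∀ s : ℂ, 0 < s.im → F s = exp (-G s)) (a s : ℂ) :
    meromorphicOrderAt (fun z => F z - a) s ≠ ⊤ := by
  obtain ⟨s₀, h0, hd⟩ := hG.exists_deriv_ne_zero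
  have hm : Meromorphic fun z => F z - a := fun z => (hF z).sub (MeromorphicAt.const a z)
  refine MeromorphicOn.meromorphicOrderAt_ne_top_of_isPreconnected
    (U := Set.univ) (y := s) (x := s₀) (fun z _ => hm z) isPreconnected_univ (Set.mem_univ _) (Set.mem_univ _) ?_
  by_cases h : F s₀ = a
  · rw [← h, hG.order_sub_eq_one hexp h0 hd]
    exact WithTop.coe_ne_top
  · have h1 : AnalyticAt ℂ (fun z => F z - a) s₀ :=
      (hG.analyticAt_of_eq_exp hexp h0).sub analyticAt_const
    rw [h1.meromorphicOrderAt_eq, h1.analyticOrderAt_eq_zero.2 (sub_ne_zero.2 h)]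
    exact WithTop.coe_ne_top

lemma multiplicity_eq_one (hG : IsCriticalPhase G κ C)
    (hexp : ∀ s : ℂ, 0 < s.im → F s = exp (-G s)) {s : ℂ} (hs : 0 < s.im)
    (hd : deriv G s ≠ 0) : aPointMultiplicity F (F s) s = 1 := by
  rw [aPointMultiplicity, hG.order_sub_eq_one hexp hs hd]
  rfl

lemma finite_aPointsInStrip (hG : IsCriticalPhase G κ C) (hF : Meromorphic F)
    (hexp : ∀ s : ℂ, 0 < s.im → F s = exp (-G s)) (a : ℂ) (T : ℝ) :
    (aPointsInStrip F a T).Finite := by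
  have hm : Meromorphic fun z => F z - a := fun z => (hF z).sub (MeromorphicAt.const a z)
  refine ((MeromorphicOn.divisor (fun z => F z - a)
    (Metric.closedBall 0 (1 + |T|))).finiteSupport (isCompact_closedBall _ _)).subset ?_
  rintro s ⟨hs, h0, h1, h2, h3⟩
  have hball : s ∈ Metric.closedBall (0 : ℂ) (1 + |T|) := by
    rw [mem_closedBall_zero_iff]
    refine (norm_le_abs_re_add_abs_im s).trans ?_
    rw [abs_of_pos h0, abs_of_pos h2]
    linarith [le_abs_self T]
  rw [Function.mem_support, MeromorphicOn.divisor_apply (fun z _ => hm z) hball]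
  intro h
  -- The divisor also vanishes where the order is `⊤`, so that case has to be excluded.
  rw [WithTop.untop₀_eq_zero] at h
  rcases h with h | h
  · exact (ne_of_gt hs) h
  · exact hG.order_sub_ne_top hF hexp a s h

/-- The `a`-points high up in the critical strip: they approach the critical line and can be counted. -/
lemma exists_count (hG : IsCriticalPhase G κ C)
    (hexp : ∀ s : ℂ, 0 < s.im → F s = exp (-G s)) {a : ℂ} (ha : a ≠ 0) {η : ℝ} (h0 : 0 < η)
    (hη : η < 1 / 2) :
    ∃ t₁ M : ℝ, 1 ≤ t₁ ∧
      (∀ s ∈ upperStrip t₁, F s = a → |s.re - 1 / 2| ≤ η ∧ deriv G s ≠ 0) ∧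
      ∀ T, t₁ ≤ T → |(({s : ℂ | F s = a ∧ 0 < s.re ∧ s.re < 1 ∧ t₁ < s.im ∧ s.im < T}.ncard : ℕ) : ℝ)
        - T / (2 * Real.pi) * (Real.log (κ * T) - 1)| ≤ M + C / (2 * Real.pi) * Real.log T := by
  obtain ⟨t₁, h1, p, hp, huniq, hcont, hmono, hd, hhalf⟩ :=
    hG.exists_level_curve (-Real.log ‖a‖) h0 hη
  set h : ℝ → ℝ := fun t => (G (p t)).im
  have hpi := Real.pi_pos
  have hF : ∀ s ∈ upperStrip t₁, F s = a ↔
      (G s).re = -Real.log ‖a‖ ∧ ∃ k : ℤ, (G s).im = -arg a + 2 * Real.pi * k := fun s hs => by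
    rw [hexp s (by linarith [hs.2.2]), exp_neg_eq_iff ha]
  have hpm : ∀ t, t₁ ≤ t → p t ∈ upperStrip t₁ := by
    intro t ht
    obtain ⟨h2, h3, -⟩ := hp t ht
    rw [abs_le] at h3
    exact ⟨by linarith, by linarith, by rw [h2]; exact ht⟩
  have hstrict : ∀ t t', t₁ ≤ t → t < t' → h t < h t' := fun t t' ht htt => by
    have := hmono t t' ht htt.le
    linarith
  have hltiff : ∀ t t', t₁ ≤ t → t₁ ≤ t' → h t < h t' → t < t' := fun t t' ht ht' hlt => by
    by_contra hle
    rcases (not_lt.1 hle).eq_or_lt with h2 | h2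
    · rw [h2] at hlt; exact lt_irrefl _ hlt
    · exact lt_asymm hlt (hstrict _ _ ht' h2)
  set M₀ := |(G (1 / 2 + (1 : ℝ) * I)).im - (Real.log κ - 1)|
  refine ⟨t₁, 1 + (M₀ + 1 + |h t₁|) / (2 * Real.pi), h1, ?_, ?_⟩
  · intro s hs hsa
    constructor
    · have h2 := huniq s hs ((hF s hs).1 hsa).1
      rw [h2]
      exact (hp s.im hs.2.2).2.1
    · intro h2
      have := hd s hs
      rw [h2] at this
      norm_num at this
  intro T hT
  set A := {s : ℂ | F s = a ∧ 0 < s.re ∧ s.re < 1 ∧ t₁ < s.im ∧ s.im < T}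
  set x := (h t₁ + arg a) / (2 * Real.pi)
  set y := (h T + arg a) / (2 * Real.pi)
  set K := {k : ℤ | x < k ∧ (k : ℝ) < y}
  have hTh : h t₁ ≤ h T := by
    have := hmono t₁ T le_rfl hT
    linarith
  have hxy : x ≤ y := by
    simp only [x, y]; gcongr
  have hKiff : ∀ k : ℤ, k ∈ K ↔ h t₁ < -arg a + 2 * Real.pi * k ∧ -arg a + 2 * Real.pi * k < h T := by
    intro k
    simp only [K, x, y, Set.mem_ofPred_eq]
    rw [div_lt_iff₀ (by positivity), lt_div_iff₀ (by positivity)]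
    constructor <;> rintro ⟨h2, h3⟩ <;> constructor <;> linarith
  -- Each integer in `K` is matched with the point of the level curve whose phase is `-arg a + 2πk`;
  -- strict monotonicity of the phase makes this a bijection from `K` onto `A`.
  have hψ : ∀ k : ℤ, ∃ s : ℂ, k ∈ K → s ∈ A ∧ (G s).im = -arg a + 2 * Real.pi * k := by
    intro k
    by_cases hk : k ∈ K
    · have hk' := (hKiff k).1 hk
      obtain ⟨t, ht, hteq⟩ := intermediate_value_Icc hT
        (hcont.mono Set.Icc_subset_Ici_self) ⟨hk'.1.le, hk'.2.le⟩
      have hteq : h t = -arg a + 2 * Real.pi * k := hteq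
      have hlo : t₁ < t := hltiff _ _ le_rfl ht.1 (by rw [hteq]; exact hk'.1)
      have hhi : t < T := hltiff _ _ ht.1 hT (by rw [hteq]; exact hk'.2)
      have hm := hpm t ht.1
      refine ⟨p t, fun _ => ⟨⟨(hF _ hm).2 ⟨(hp t ht.1).2.2, k, hteq⟩, hm.1, hm.2.1, ?_, ?_⟩, hteq⟩⟩
      · rw [(hp t ht.1).1]; exact hlo
      · rw [(hp t ht.1).1]; exact hhi
    · exact ⟨0, fun h => absurd h hk⟩
  choose ψ hψ using hψ
  have himage : A = ψ '' K := by
    ext s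
    constructor
    · rintro ⟨hsa, hs0, hs1, hst, hsT⟩
      have hm : s ∈ upperStrip t₁ := ⟨hs0, hs1, hst.le⟩
      obtain ⟨hre, k, hk⟩ := (hF s hm).1 hsa
      have hsp := huniq s hm hre
      have hh : h s.im = -arg a + 2 * Real.pi * k := by
        simp only [h]; rw [← hsp, hk]
      have hkK : k ∈ K := by
        rw [hKiff, ← hh]
        exact ⟨hstrict _ _ le_rfl hst, hstrict _ _ hst.le hsT⟩
      refine ⟨k, hkK, ?_⟩
      obtain ⟨⟨h2, h3, h4, h5, h6⟩, h7⟩ := hψ k hkK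
      have hm' : ψ k ∈ upperStrip t₁ := ⟨h3, h4, h5.le⟩
      have hsp' := huniq _ hm' ((hF _ hm').1 h2).1
      have hh' : h (ψ k).im = -arg a + 2 * Real.pi * k := by
        simp only [h]; rw [← hsp', h7]
      have him : (ψ k).im = s.im := by
        rcases lt_trichotomy (ψ k).im s.im with hlt | heq | hlt
        · have := hstrict _ _ h5.le hlt
          linarith
        · exact heq
        · have := hstrict _ _ hst.le hlt
          linarith
      rw [hsp', him, ← hsp]
    · rintro ⟨k, hk, rfl⟩
      exact (hψ k hk).1
  have hinj : Set.InjOn ψ K := by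
    intro k hk k' hk' hkk
    have h2 := (hψ k hk).2
    have h3 := (hψ k' hk').2
    rw [hkk, h3] at h2
    have h4 : 2 * Real.pi * (k : ℝ) = 2 * Real.pi * k' := by linarith
    exact_mod_cast mul_left_cancel₀ (by positivity) h4
  rw [himage, hinj.ncard_image]
  have hc := abs_ncard_int_Ioo_sub_le hxy
  have hyx : y - x = (h T - h t₁) / (2 * Real.pi) := by
    simp only [x, y]; ring
  have hT1 : 1 ≤ T := h1.trans hT
  have e1 := hhalf T hT
  have e2 := hG.im_half_estimate hT1
  have e3 : |h T - h t₁ - T * (Real.log (κ * T) - 1)| ≤ M₀ + 1 + |h t₁| + C * Real.log T := by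
    have : h T - h t₁ - T * (Real.log (κ * T) - 1) = (h T - (G (1 / 2 + T * I)).im)
      + ((G (1 / 2 + T * I)).im - (T * Real.log (κ * T) - T)) + -h t₁ := by ring
    rw [this]
    refine (abs_add_le _ _).trans ((add_le_add (abs_add_le _ _) le_rfl).trans ?_)
    rw [abs_neg]
    linarith
  have e4 : |(y - x) - T / (2 * Real.pi) * (Real.log (κ * T) - 1)|
      ≤ (M₀ + 1 + |h t₁|) / (2 * Real.pi) + C / (2 * Real.pi) * Real.log T := by
    have e5 : (y - x) - T / (2 * Real.pi) * (Real.log (κ * T) - 1)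
        = (h T - h t₁ - T * (Real.log (κ * T) - 1)) / (2 * Real.pi) := by rw [hyx]; ring
    rw [e5, abs_div, abs_of_pos (by positivity : 0 < 2 * Real.pi), div_le_iff₀ (by positivity)]
    refine e3.trans (le_of_eq ?_)
    field_simp
  have := abs_sub_le ((K.ncard : ℕ) : ℝ) (y - x) (T / (2 * Real.pi) * (Real.log (κ * T) - 1))
  linarith

lemma tendsto_count_atTop (hκ : 0 < κ) (M C : ℝ) :
    Tendsto (fun T : ℝ => T / (2 * Real.pi) * (Real.log (κ * T) - 1)
      - (M + C / (2 * Real.pi) * Real.log T)) atTop atTop := by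
  have hpi := Real.pi_pos
  have h1 : Tendsto (fun T : ℝ => Real.log (κ * T) - 1) atTop atTop :=
    tendsto_atTop_add_const_right _ (-1)
      (Real.tendsto_log_atTop.comp (tendsto_id.const_mul_atTop hκ))
  have hlog : ∀ᶠ T : ℝ in atTop, (C / (2 * Real.pi) * Real.log T) ≤ |C| / (2 * Real.pi) * T := by
    filter_upwards [eventually_ge_atTop 1] with T hT
    have h2 : Real.log T ≤ T := (Real.log_le_sub_one_of_pos (by linarith)).trans (by linarith)
    have h3 : 0 ≤ Real.log T := Real.log_nonneg hT
    refine mul_le_mul ?_ h2 h3 (by positivity)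
    gcongr
    exact le_abs_self C
  have h4 : Tendsto (fun T : ℝ => T / (2 * Real.pi) - M) atTop atTop :=
    tendsto_atTop_add_const_right _ (-M) (tendsto_id.atTop_div_const (by positivity))
  refine tendsto_atTop_mono' _ ?_ h4
  filter_upwards [hlog, h1.eventually_ge_atTop (1 + |C|), eventually_ge_atTop 0] with T hT hT' hT0
  have h5 : T / (2 * Real.pi) * (1 + |C|) ≤ T / (2 * Real.pi) * (Real.log (κ * T) - 1) := by
    gcongr
  have h6 : T / (2 * Real.pi) * (1 + |C|) = T / (2 * Real.pi) + |C| / (2 * Real.pi) * T := by ring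
  linarith

/-- The critical line is a Julia line. -/
theorem isJuliaLine (hG : IsCriticalPhase G κ C)
    (hexp : ∀ s : ℂ, 0 < s.im → F s = exp (-G s)) : IsJuliaLine F (1 / 2) := by
  intro ε hε
  have key : ∀ a : ℂ, a ≠ 0 → {s : ℂ | |s.re - 1 / 2| < ε ∧ IsAPoint F a s}.Infinite := by
    intro a ha hfin
    -- `ε / 2` makes the distance to the line strictly less than `ε`; `1 / 4` meets the condition `η
    -- < 1 / 2`.
    have h0 : 0 < min (ε / 2) (1 / 4) := by positivity
    obtain ⟨t₁, M, h1, hline, hcount⟩ := hG.exists_count hexp ha h0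
      (by linarith [min_le_right (ε / 2) (1 / 4)])
    have hb : ∀ T, t₁ ≤ T →
        ({s : ℂ | F s = a ∧ 0 < s.re ∧ s.re < 1 ∧ t₁ < s.im ∧ s.im < T}.ncard : ℝ)
          ≤ {s : ℂ | |s.re - 1 / 2| < ε ∧ IsAPoint F a s}.ncard := by
      intro T hT
      have : {s : ℂ | F s = a ∧ 0 < s.re ∧ s.re < 1 ∧ t₁ < s.im ∧ s.im < T}
          ⊆ {s : ℂ | |s.re - 1 / 2| < ε ∧ IsAPoint F a s} := by
        rintro s ⟨hsa, hs0, hs1, hst, hsT⟩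
        refine ⟨?_, (hG.isAPoint_iff hexp (by linarith) a).2 hsa⟩
        have h2 := (hline s ⟨hs0, hs1, hst.le⟩ hsa).1
        have h3 := min_le_left (ε / 2) (1 / 4)
        linarith
      exact_mod_cast Set.ncard_le_ncard this hfin
    have h2 := tendsto_count_atTop hG.pos M C
    obtain ⟨T, hT, hT'⟩ := ((h2.eventually_gt_atTop
      ({s : ℂ | |s.re - 1 / 2| < ε ∧ IsAPoint F a s}.ncard : ℝ)).and
      (eventually_ge_atTop t₁)).exists
    have h3 := abs_le.1 (hcount T hT')
    linarith [hb T hT', h3.1]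
  intro a ha b hb
  have ha' : a = 0 := by by_contra h; exact ha (key a h)
  have hb' : b = 0 := by by_contra h; exact hb (key b h)
  rw [ha', hb']

/-- The counting function of the `a`-points in the critical strip. -/
theorem exists_aPointCount_bound (hG : IsCriticalPhase G κ C) (hF : Meromorphic F)
    (hexp : ∀ s : ℂ, 0 < s.im → F s = exp (-G s)) {a : ℂ} (ha : a ≠ 0) :
    ∃ t₁ M : ℝ, ∀ T, t₁ < T → |(aPointCount F a T : ℝ)
        - T / (2 * Real.pi) * (Real.log (κ * T) - 1)| ≤ M + C / (2 * Real.pi) * Real.log T := by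
  obtain ⟨t₁, M, h1, hline, hcount⟩ := hG.exists_count hexp ha (η := 1 / 4) (by norm_num)
    (by norm_num)
  -- The low `a`-points, possibly multiple, contribute a constant independent of `T`; those above
  -- `t₁` are simple.
  set B : Set ℂ := {s | IsAPoint F a s ∧ 0 < s.re ∧ s.re < 1 ∧ 0 < s.im ∧ s.im ≤ t₁}
  refine ⟨t₁, M + (∑ᶠ s ∈ B, aPointMultiplicity F a s : ℕ), fun T hT => ?_⟩
  set A := {s : ℂ | F s = a ∧ 0 < s.re ∧ s.re < 1 ∧ t₁ < s.im ∧ s.im < T}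
  have hunion : aPointsInStrip F a T = B ∪ A := by
    ext s
    constructor
    · rintro ⟨hs, hs0, hs1, hst, hsT⟩
      rcases le_or_gt s.im t₁ with h | h
      · exact Or.inl ⟨hs, hs0, hs1, hst, h⟩
      · exact Or.inr ⟨(hG.isAPoint_iff hexp hst a).1 hs, hs0, hs1, h, hsT⟩
    · rintro (⟨hs, hs0, hs1, hst, hsT⟩ | ⟨hs, hs0, hs1, hst, hsT⟩)
      · exact ⟨hs, hs0, hs1, hst, by linarith⟩
      · exact ⟨(hG.isAPoint_iff hexp (by linarith) a).2 hs, hs0, hs1, by linarith, hsT⟩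
  have hdisj : Disjoint B A := by
    rw [Set.disjoint_left]
    rintro s ⟨-, -, -, -, h2⟩ ⟨-, -, -, h3, -⟩
    linarith
  have hfin := hG.finite_aPointsInStrip hF hexp a T
  rw [hunion] at hfin
  have hAsum : ∑ᶠ s ∈ A, aPointMultiplicity F a s = A.ncard := by
    rw [← finsum_one]
    refine finsum_mem_congr rfl ?_
    rintro s ⟨hs, hs0, hs1, hst, hsT⟩
    have := hG.multiplicity_eq_one hexp (s := s) (by linarith) (hline s ⟨hs0, hs1, hst.le⟩ hs).2
    rwa [hs] at this
  have hsum : aPointCount F a T = (∑ᶠ s ∈ B, aPointMultiplicity F a s) + A.ncard := by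
    rw [aPointCount, hunion, finsum_mem_union hdisj (hfin.subset Set.subset_union_left)
      (hfin.subset Set.subset_union_right), hAsum]
  rw [hsum]
  have := abs_le.1 (hcount T hT.le)
  push_cast
  have h5 : (0 : ℝ) ≤ ((∑ᶠ s ∈ B, aPointMultiplicity F a s : ℕ) : ℝ) := Nat.cast_nonneg _
  rw [abs_le]
  constructor <;> linarith [this.1, this.2]

end IsCriticalPhase

/-! ### Growth of Γ and of its reciprocal -/

/-- With `n = ⌈u⌉`, logarithmic convexity and `Γ(n) ≤ n^(n-1)` give `Γ(u+1) ≤ n^u`. Dividing by `u ≥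
1/2` costs the `log 2`. -/
lemma Real.log_Gamma_le {u : ℝ} (hu : 1 / 2 ≤ u) :
    Real.log (Real.Gamma u) ≤ u * Real.log (u + 1) + Real.log 2 := by
  have hu0 : 0 < u := by linarith
  set n := ⌈u⌉₊
  have hn : n ≠ 0 := (Nat.ceil_pos.2 hu0).ne'
  have hn0 : (0 : ℝ) < n := by positivity
  have h1 : u ≤ n := Nat.le_ceil u
  have h2 : (n : ℝ) < u + 1 := Nat.ceil_lt_add_one hu0.le
  have h3 : Real.log (Real.Gamma (n + (u + 1 - n)))
      ≤ Real.log (Real.Gamma n) + (u + 1 - n) * Real.log n :=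
    Real.BohrMollerup.f_add_nat_le (f := Real.log ∘ Real.Gamma) (x := u + 1 - n) (n := n) Real.convexOn_log_Gamma
      (fun {y} hy => by
        rw [Function.comp_apply, Real.Gamma_add_one hy.ne',
          Real.log_mul hy.ne' (Real.Gamma_pos_of_pos hy).ne', add_comm, Function.comp_apply])
      hn (by linarith) (by linarith)
  have h4 : Real.log (Real.Gamma n) ≤ (n - 1) * Real.log n := by
    obtain ⟨m, hm⟩ := Nat.exists_eq_succ_of_ne_zero hn
    rw [hm, Nat.succ_eq_add_one, Nat.cast_add_one, Real.Gamma_nat_eq_factorial, add_sub_cancel_right,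
      ← Real.log_pow]
    refine Real.log_le_log (by positivity) ?_
    calc ((m.factorial : ℕ) : ℝ) ≤ ((m ^ m : ℕ) : ℝ) := by exact_mod_cast m.factorial_le_pow
      _ = (m : ℝ) ^ m := by push_cast; rfl
      _ ≤ ((m : ℝ) + 1) ^ m := by gcongr; linarith
  rw [show (n : ℝ) + (u + 1 - n) = u + 1 by ring, Real.Gamma_add_one hu0.ne',
    Real.log_mul hu0.ne' (Real.Gamma_pos_of_pos hu0).ne'] at h3
  have h5 : Real.log n ≤ Real.log (u + 1) := Real.log_le_log hn0 h2.le
  have h6 : -Real.log 2 ≤ Real.log u := by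
    rw [← Real.log_inv]
    exact Real.log_le_log (by norm_num) (by rw [← one_div]; exact hu)
  have h7 : u * Real.log n ≤ u * Real.log (u + 1) := by gcongr
  linarith

lemma exists_pos_le_Gamma : ∃ c : ℝ, 0 < c ∧ ∀ x : ℝ, 1 / 2 ≤ x → c ≤ Real.Gamma x := by
  obtain ⟨x₀, hx₀, hmin⟩ := (isCompact_Icc (a := (1 / 2 : ℝ)) (b := 2)).exists_isMinOn
    ⟨1, by norm_num⟩ (Real.differentiableOn_Gamma_Ioi.continuousOn.mono fun x hx => by
      have := hx.1
      show 0 < x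
      linarith)
  have h0 : 0 < Real.Gamma x₀ := Real.Gamma_pos_of_pos (by linarith [hx₀.1])
  refine ⟨min 1 (Real.Gamma x₀), by positivity, fun x hx => ?_⟩
  rcases le_total x 2 with h | h
  · exact (min_le_right _ _).trans (hmin ⟨hx, h⟩)
  · refine (min_le_left _ _).trans ?_
    rw [← Real.Gamma_two]
    exact Real.Gamma_strictMonoOn_Ici.monotoneOn (Set.self_mem_Ici) h h

lemma norm_exp_mul_I_le (z : ℂ) : ‖exp (z * I)‖ ≤ Real.exp |z.im| := by
  rw [norm_exp, Real.exp_le_exp]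
  simp [neg_le_abs]

lemma norm_sin_le_exp (z : ℂ) : ‖Complex.sin z‖ ≤ Real.exp |z.im| := by
  rw [Complex.sin, norm_div, norm_mul, norm_I, mul_one, Complex.norm_ofNat]
  have h1 := norm_exp_mul_I_le z
  have h2 := norm_exp_mul_I_le (-z)
  rw [neg_im, abs_neg] at h2
  have := norm_sub_le (exp (-z * I)) (exp (z * I))
  linarith

/-- The growth of the reciprocal Gamma function. -/
lemma exists_posLog_norm_inv_Gamma_le : ∃ B : ℝ, 0 ≤ B ∧ ∀ (r : ℝ) (s : ℂ), ‖s‖ = r →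
    Real.posLog ‖(Gamma (1 - s))⁻¹‖ ≤ max s.re 0 * Real.log (r + 1) + Real.pi * r + B := by
  obtain ⟨c, hc, hG⟩ := exists_pos_le_Gamma
  refine ⟨|Real.log c| + Real.log 2, by positivity, fun r s hs => ?_⟩
  have hr : 0 ≤ r := hs ▸ norm_nonneg s
  have him : |s.im| ≤ r := hs ▸ abs_im_le_norm s
  have hre : s.re ≤ r := (le_abs_self _).trans (hs ▸ abs_re_le_norm s)
  have hpi := Real.pi_pos
  have hlogr : 0 ≤ Real.log (r + 1) := Real.log_nonneg (by linarith)
  have hm : 0 ≤ max s.re 0 * Real.log (r + 1) := mul_nonneg (le_max_right _ _) hlogr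
  have hl2 : 0 < Real.log 2 := Real.log_pos (by norm_num)
  rw [Real.posLog_apply]
  refine max_le (by positivity) ?_
  by_cases h0 : Gamma (1 - s) = 0
  · rw [h0]; simp; positivity
  -- For `Re (1 - s) ≥ 1/2`, comparison with the critical line gives only exponential growth.
  -- Otherwise `1/Γ(1-s) = Γ(s) sin (πs) / π`, and `Γ(Re s)` produces the main term.
  rcases le_or_gt (1 / 2) (1 - s).re with h | h
  · have h1 := Gamma_re_mul_norm_Gamma_half_le h
    have h2 := norm_sq_Gamma_half_add_mul_I (1 - s).im
    set g := ‖Gamma (1 / 2 + (1 - s).im * I)‖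
    set y := (1 - s).im
    have hy : |y| ≤ r := by simpa [y] using him
    have hcosh : Real.cosh (Real.pi * y) ≤ Real.exp (Real.pi * r) := by
      rw [← Real.cosh_abs, abs_mul, abs_of_pos hpi, Real.cosh_eq]
      have h3 : Real.exp (Real.pi * |y|) ≤ Real.exp (Real.pi * r) :=
        Real.exp_le_exp.2 (by gcongr)
      have h4 : Real.exp (-(Real.pi * |y|)) ≤ Real.exp (Real.pi * r) :=
        Real.exp_le_exp.2 (by nlinarith [abs_nonneg y])
      linarith
    have hcp := Real.cosh_pos (Real.pi * y)
    have hg : 0 < g := by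
      have : 0 < g ^ 2 := by rw [h2]; positivity
      exact (norm_nonneg _).lt_of_ne fun h => by simp [g, ← h] at this
    have hΓ := norm_pos_iff.2 h0
    have hΓr := hG _ h
    have hG2 : Real.Gamma (1 / 2) ^ 2 = Real.pi := by
      rw [Real.Gamma_one_half_eq, Real.sq_sqrt hpi.le]
    have hinv : ‖(Gamma (1 - s))⁻¹‖ ^ 2 ≤ Real.exp (Real.pi * r) / c ^ 2 := by
      rw [norm_inv, inv_pow, inv_eq_one_div, div_le_div_iff₀ (by positivity) (by positivity)]
      have h5 : (c * g) ^ 2 ≤ (Real.Gamma (1 / 2) * ‖Gamma (1 - s)‖) ^ 2 := by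
        refine pow_le_pow_left₀ (by positivity) (le_trans ?_ h1) 2
        gcongr
      rw [mul_pow, mul_pow, hG2, h2, mul_div_assoc', div_le_iff₀ hcp] at h5
      have h6 : c ^ 2 * Real.pi ≤ Real.pi * (‖Gamma (1 - s)‖ ^ 2 * Real.exp (Real.pi * r)) := by
        refine h5.trans ?_
        rw [mul_assoc]
        gcongr
      have h7 := le_of_mul_le_mul_left ((mul_comm _ _).trans_le h6) hpi
      linarith
    have hinvpos : 0 < ‖(Gamma (1 - s))⁻¹‖ := norm_pos_iff.2 (inv_ne_zero h0)
    have h8 := Real.log_le_log (by positivity) hinv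
    rw [Real.log_pow, Real.log_div (by positivity) (by positivity), Real.log_exp, Real.log_pow] at h8
    push_cast at h8
    have := neg_abs_le (Real.log c)
    have : 0 ≤ Real.pi * r := by positivity
    linarith
  · have hsre : 1 / 2 < s.re := by simp at h; linarith
    have hΓs : Gamma s ≠ 0 := Gamma_ne_zero_of_re_pos (by linarith)
    have hrefl := Gamma_mul_Gamma_one_sub s
    have hsin : Complex.sin (Real.pi * s) ≠ 0 := by
      intro h9
      rw [h9, div_zero] at hrefl
      exact mul_ne_zero hΓs h0 hrefl
    have e : (Gamma (1 - s))⁻¹ = Gamma s * Complex.sin (Real.pi * s) / Real.pi := by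
      have hpi0 : (Real.pi : ℂ) ≠ 0 := by exact_mod_cast hpi.ne'
      rw [eq_div_iff hsin] at hrefl
      rw [eq_div_iff hpi0, inv_mul_eq_iff_eq_mul₀ h0]
      linear_combination -hrefl
    have h1 : ‖(Gamma (1 - s))⁻¹‖ ≤ Real.Gamma s.re * Real.exp (Real.pi * r) := by
      rw [e, norm_div, norm_mul, norm_real, Real.norm_of_nonneg hpi.le]
      have h2 := norm_Gamma_le_Gamma_re (z := s) (by linarith)
      have h3 : ‖Complex.sin (Real.pi * s)‖ ≤ Real.exp (Real.pi * r) := by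
        refine (norm_sin_le_exp _).trans (Real.exp_le_exp.2 ?_)
        rw [im_ofReal_mul, abs_mul, abs_of_pos hpi]
        gcongr
      have h4 : ‖Gamma s‖ * ‖Complex.sin (Real.pi * s)‖ ≤ Real.Gamma s.re * Real.exp (Real.pi * r) := by
        gcongr
      refine (div_le_self (by positivity) (by linarith [Real.pi_gt_three])).trans h4
    have hΓpos : 0 < Real.Gamma s.re := Real.Gamma_pos_of_pos (by linarith)
    have h2 := Real.log_le_log (norm_pos_iff.2 (inv_ne_zero h0)) h1
    rw [Real.log_mul hΓpos.ne' (Real.exp_pos _).ne', Real.log_exp] at h2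
    have h3 := Real.log_Gamma_le hsre.le
    have h4 : s.re * Real.log (s.re + 1) ≤ max s.re 0 * Real.log (r + 1) := by
      refine mul_le_mul (le_max_left _ _) ?_ (Real.log_nonneg (by linarith)) (le_max_right _ _)
      exact Real.log_le_log (by linarith) (by linarith)
    have := abs_nonneg (Real.log c)
    linarith

/-- The average of `max (Re s) 0` over a circle. -/
lemma circleAverage_max_re {r : ℝ} (hr : 0 ≤ r) :
    Real.circleAverage (fun s : ℂ => max s.re 0) 0 r = r / Real.pi := by
  have hpi := Real.pi_pos
  -- The rotation turns the cosine into a sine, whose positive part lives on `[0, π]`.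
  rw [Real.circleAverage_eq_integral_add (-(Real.pi / 2))]
  have e : ∀ θ : ℝ, max (circleMap 0 r (θ + -(Real.pi / 2))).re 0 = r * max (Real.sin θ) 0 := by
    intro θ
    have h1 : (circleMap 0 r (θ + -(Real.pi / 2))).re = r * Real.sin θ := by
      rw [circleMap, zero_add, re_ofReal_mul, exp_ofReal_mul_I_re, ← sub_eq_add_neg,
        Real.cos_sub_pi_div_two]
    rw [h1, mul_max_of_nonneg _ _ hr, mul_zero]
  simp only [e]
  rw [intervalIntegral.integral_const_mul]
  have hc : Continuous fun θ : ℝ => max (Real.sin θ) 0 := by fun_prop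
  rw [← intervalIntegral.integral_add_adjacent_intervals (b := Real.pi)
    (hc.intervalIntegrable _ _) (hc.intervalIntegrable _ _)]
  have h1 : ∫ θ in (0 : ℝ)..Real.pi, max (Real.sin θ) 0 = ∫ θ in (0 : ℝ)..Real.pi, Real.sin θ := by
    refine intervalIntegral.integral_congr fun θ hθ => ?_
    rw [Set.uIcc_of_le hpi.le] at hθ
    exact max_eq_left (Real.sin_nonneg_of_mem_Icc hθ)
  have h2 : ∫ θ in Real.pi..(2 * Real.pi), max (Real.sin θ) 0 = 0 := by
    rw [intervalIntegral.integral_congr (g := fun _ => (0 : ℝ)), intervalIntegral.integral_zero]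
    intro θ hθ
    rw [Set.uIcc_of_le (by linarith)] at hθ
    refine max_eq_right ?_
    have := Real.sin_nonneg_of_nonneg_of_le_pi (x := θ - Real.pi) (by linarith [hθ.1])
      (by linarith [hθ.2])
    rw [Real.sin_sub_pi] at this
    linarith
  rw [h1, h2, integral_sin]
  simp
  field_simp
  ring

/-! ### Upper bounds for the characteristic, the zeros and the poles -/

open ValueDistribution

lemma logCounting_top_of_differentiable {f : ℂ → ℂ} (hf : Differentiable ℂ f) :
    logCounting f ⊤ = 0 := by
  rw [logCounting_top]
  have h : 0 ≤ MeromorphicOn.divisor f Set.univ :=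
    MeromorphicOn.AnalyticOnNhd.divisor_nonneg fun z _ => hf.analyticAt z
  rw [negPart_eq_zero.2 h, map_zero]

lemma characteristic_top_le_of_differentiable {f : ℂ → ℂ} (hf : Differentiable ℂ f) {r : ℝ}
    {b : ℂ → ℝ} (hb : Continuous b) (h : ∀ s : ℂ, ‖s‖ = |r| → Real.posLog ‖f s‖ ≤ b s) :
    characteristic f ⊤ r ≤ Real.circleAverage b 0 r := by
  rw [characteristic, logCounting_top_of_differentiable hf, add_zero, proximity_top]
  refine Real.circleAverage_mono ?_ ?_ ?_
  · exact MeromorphicOn.circleIntegrable_posLog_norm fun z _ => (hf.analyticAt z).meromorphicAt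
  · exact hb.continuousOn.circleIntegrable'
  · intro s hs
    exact h s (by simpa using hs)

lemma meromorphic_of_differentiable {f : ℂ → ℂ} (hf : Differentiable ℂ f) : Meromorphic f :=
  fun z => (hf.analyticAt z).meromorphicAt

lemma order_ne_top_of_differentiable {f : ℂ → ℂ} (hf : Differentiable ℂ f) {z₀ : ℂ}
    (h : f z₀ ≠ 0) (z : ℂ) : meromorphicOrderAt f z ≠ ⊤ := by
  refine MeromorphicOn.meromorphicOrderAt_ne_top_of_isPreconnected
    (U := Set.univ) (y := z) (x := z₀) (fun z _ => meromorphic_of_differentiable hf z)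
    isPreconnected_univ (Set.mem_univ _) (Set.mem_univ _) ?_
  rw [(hf.analyticAt z₀).meromorphicOrderAt_eq, (hf.analyticAt z₀).analyticOrderAt_eq_zero.2 h]
  exact WithTop.coe_ne_top

/-- The integrated counting function of the zeros of `f` is at most the characteristic of `f`. -/
lemma logCounting_zero_le_characteristic {f : ℂ → ℂ} (hf : Meromorphic f) :
    ∃ c : ℝ, ∀ r, logCounting f 0 r ≤ characteristic f ⊤ r + c := by
  refine ⟨max |Real.log ‖f 0‖| |Real.log ‖meromorphicTrailingCoeffAt f 0‖|, fun r => ?_⟩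
  -- First Main Theorem: `f` and `f⁻¹` have the same characteristic up to a constant, and zeros of
  -- `f` are poles of `f⁻¹`.
  have h1 := abs_le.1 (characteristic_sub_characteristic_inv_le hf (R := r))
  have h2 : logCounting f 0 r ≤ characteristic f⁻¹ ⊤ r := by
    rw [characteristic, Pi.add_apply, logCounting_inv]
    have := proximity_nonneg (f := f⁻¹) (a := ⊤) r
    simp only [Pi.zero_apply] at this
    linarith
  linarith [h1.1]

/-- If `f * g` is holomorphic for an entire function `g`, the poles of `f` are bounded by the zeros
of `g`. -/
lemma logCounting_top_le_of_mul_eq {f g h : ℂ → ℂ} (hf : Meromorphic f)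
    (hf' : ∀ z, meromorphicOrderAt f z ≠ ⊤) (hg : Differentiable ℂ g)
    (hg' : ∀ z, meromorphicOrderAt g z ≠ ⊤) (hh : Differentiable ℂ h)
    (heq : ∀ z, g z ≠ 0 → f z * g z = h z) {r : ℝ} (hr : 1 ≤ r) :
    logCounting f ⊤ r ≤ logCounting g 0 r := by
  rw [logCounting_top, logCounting_zero]
  refine Function.locallyFinsuppWithin.logCounting_le ?_ hr
  have hgm := meromorphic_of_differentiable hg
  have hnn : 0 ≤ MeromorphicOn.divisor f Set.univ + MeromorphicOn.divisor g Set.univ := by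
    rw [← MeromorphicOn.divisor_mul hf.meromorphicOn hgm.meromorphicOn (fun z _ => hf' z)
      (fun z _ => hg' z)]
    intro z
    have hfg : Meromorphic (f * g) := fun z => (hf z).mul (hgm z)
    rw [MeromorphicOn.divisor_apply (fun z _ => hfg z) (Set.mem_univ z)]
    have h1 : (f * g) =ᶠ[𝓝[≠] z] h := by
      filter_upwards [(meromorphicOrderAt_ne_top_iff_eventually_ne_zero (hgm z)).1 (hg' z)]
        with w hw using heq w hw
    rw [meromorphicOrderAt_congr h1]
    exact WithTop.untop₀_nonneg.2 (hh.analyticAt z).meromorphicOrderAt_nonneg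
  have h2 : -MeromorphicOn.divisor f Set.univ ≤ MeromorphicOn.divisor g Set.univ := by
    rw [neg_le_iff_add_nonneg, add_comm]; exact hnn
  exact sup_le_sup_right h2 0

/-- The zero-free entire factor `-i (q / 2π)^(1 - s) / √q` of `DeltaFactor`. -/
noncomputable def powerFactor (q : ℕ) (s : ℂ) : ℂ :=
  -I * ((q : ℂ) / (2 * (Real.pi : ℂ))) ^ (1 - s) / ((Real.sqrt (q : ℝ) : ℝ) : ℂ)

namespace DeltaFactor

variable {q : ℕ} {δ : ℤ}

lemma eq_powerFactor_mul (q : ℕ) (δ : ℤ) (s : ℂ) :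
    DeltaFactor q δ s = powerFactor q s * trigFactor δ s * Gamma (1 - s) := by
  rw [eq_mul, powerFactor]; ring

lemma powerFactor_ne_zero (hq : 0 < q) (s : ℂ) : powerFactor q s ≠ 0 := by
  refine div_ne_zero (mul_ne_zero (neg_ne_zero.2 I_ne_zero) ?_) (sqrt_ne_zero hq)
  simp [cpow_eq_zero_iff, base_ne_zero hq]

lemma differentiable_powerFactor (hq : 0 < q) : Differentiable ℂ (powerFactor q) :=
  ((differentiable_base hq).const_mul (-I)).div_const _

lemma differentiable_inv_Gamma_one_sub : Differentiable ℂ fun s : ℂ => (Gamma (1 - s))⁻¹ :=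
  differentiable_one_div_Gamma.comp ((differentiable_const (1 : ℂ)).sub differentiable_id)

lemma differentiable_sin_pi : Differentiable ℂ fun s : ℂ => Complex.sin (Real.pi * s) := by
  fun_prop

/-- A difference of squares. It places the zeros of the trigonometric factor among those of `sin
πs`, with an entire cofactor. -/
lemma trigFactor_mul_trigFactor_neg (hδ : δ = 1 ∨ δ = -1) (s : ℂ) :
    trigFactor δ s * trigFactor (-δ) s = 2 * I * Complex.sin (Real.pi * s) := by
  have h1 : exp (2 * (Real.pi : ℂ) * I * (s / 4)) ^ 2 = exp (Real.pi * s * I) := by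
    rw [← exp_nat_mul]; congr 1; push_cast; ring
  have h2 : exp (2 * (Real.pi : ℂ) * I * (-(s / 4))) ^ 2 = exp (-(Real.pi * s) * I) := by
    rw [← exp_nat_mul]; congr 1; push_cast; ring
  have h3 : (2 : ℂ) * I * Complex.sin (Real.pi * s) = exp (Real.pi * s * I) - exp (-(Real.pi * s) * I) := by
    rw [Complex.sin]
    linear_combination -(exp (Real.pi * s * I) - exp (-(Real.pi * s) * I)) * I_sq
  rw [h3, ← h1, ← h2, trigFactor, trigFactor]
  rcases hδ with rfl | rfl <;> push_cast <;> ring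

lemma norm_trigFactor_le (hδ : δ = 1 ∨ δ = -1) (s : ℂ) :
    ‖trigFactor δ s‖ ≤ 2 * Real.exp (Real.pi / 2 * ‖s‖) := by
  have h1 := abs_le.1 (abs_im_le_norm s)
  have hpi := Real.pi_pos
  refine (norm_sub_le _ _).trans ?_
  rw [norm_mul, norm_delta hδ, one_mul, norm_exp_quarter, norm_exp_neg_quarter]
  have h2 : Real.exp (-(Real.pi / 2) * s.im) ≤ Real.exp (Real.pi / 2 * ‖s‖) :=
    Real.exp_le_exp.2 (by nlinarith [h1.1])
  have h3 : Real.exp (Real.pi / 2 * s.im) ≤ Real.exp (Real.pi / 2 * ‖s‖) :=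
    Real.exp_le_exp.2 (by nlinarith [h1.2])
  linarith

lemma norm_powerFactor_le (hq : 0 < q) (s : ℂ) :
    ‖powerFactor q s‖ ≤ Real.exp (|Real.log (q / (2 * Real.pi))| * (1 + ‖s‖)) := by
  have hpos : (0 : ℝ) < q / (2 * Real.pi) := by positivity
  have hq1 : 1 ≤ Real.sqrt q := Real.one_le_sqrt.2 (by exact_mod_cast hq)
  rw [powerFactor, norm_div, norm_mul, norm_neg, norm_I, one_mul, base_eq,
    norm_cpow_eq_rpow_re_of_pos hpos, norm_real, Real.norm_of_nonneg (by positivity)]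
  refine (div_le_self (by positivity) hq1).trans ?_
  rw [Real.rpow_def_of_pos hpos, Real.exp_le_exp]
  refine (le_abs_self _).trans ?_
  rw [abs_mul]
  gcongr
  rw [sub_re, one_re]
  refine (abs_sub _ _).trans ?_
  rw [abs_one]
  gcongr
  exact abs_re_le_norm s

lemma trigFactor_I_ne_zero (hδ : δ = 1 ∨ δ = -1) : trigFactor δ I ≠ 0 :=
  trigFactor_ne_zero hδ (by simp)

lemma differentiable_numerator (hq : 0 < q) (δ : ℤ) :
    Differentiable ℂ fun s => powerFactor q s * trigFactor δ s :=
  (differentiable_powerFactor hq).mul (differentiable_trigFactor δ)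

lemma log_add_one_le {r : ℝ} (hr : 1 ≤ r) : Real.log (r + 1) ≤ Real.log r + 1 / r := by
  have hr0 : 0 < r := by linarith
  have e : r + 1 = r * (1 + 1 / r) := by field_simp
  rw [e, Real.log_mul hr0.ne' (by positivity)]
  have := Real.log_le_sub_one_of_pos (x := 1 + 1 / r) (by positivity)
  linarith

/-- The upper bound for the Nevanlinna characteristic of `Δ`. -/
lemma exists_characteristic_le (hq : 0 < q) (hδ : δ = 1 ∨ δ = -1) :
    ∃ c : ℝ, ∀ r : ℝ, 1 ≤ r →
      characteristic (DeltaFactor q δ) ⊤ r ≤ r * Real.log r / Real.pi + c * r := by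
  obtain ⟨B, hB, hΓ⟩ := exists_posLog_norm_inv_Gamma_le
  have hpi := Real.pi_pos
  set L := |Real.log (q / (2 * Real.pi))|
  have hL : 0 ≤ L := abs_nonneg _
  set R : ℂ → ℂ := fun s => (Gamma (1 - s))⁻¹
  set E : ℂ → ℂ := fun s => powerFactor q s * trigFactor δ s
  have hRd : Differentiable ℂ R := differentiable_inv_Gamma_one_sub
  have hEd : Differentiable ℂ E := differentiable_numerator hq δ
  have hRm := meromorphic_of_differentiable hRd
  set c₁ := max |Real.log ‖R 0‖| |Real.log ‖meromorphicTrailingCoeffAt R 0‖|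
  have hc₁ : 0 ≤ c₁ := (abs_nonneg _).trans (le_max_left _ _)
  refine ⟨(L * 2 + Real.pi / 2 + Real.log 2) + (1 / Real.pi + Real.pi + B) + c₁, fun r hr => ?_⟩
  have hr0 : 0 < r := by linarith
  -- `E` grows at most exponentially and contributes `O(r)`; the main term comes from `R`, whose
  -- characteristic agrees with that of `R⁻¹` up to a constant.
  have hfactor : DeltaFactor q δ = E * R⁻¹ := by
    funext s
    simp [E, R, eq_powerFactor_mul]
  have hEtop : ∀ z, meromorphicOrderAt E z ≠ ⊤ := order_ne_top_of_differentiable hEd (z₀ := I)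
    (mul_ne_zero (powerFactor_ne_zero hq I) (trigFactor_I_ne_zero hδ))
  have hRtop : ∀ z, meromorphicOrderAt R z ≠ ⊤ := order_ne_top_of_differentiable hRd (z₀ := 0)
    (by simp [R])
  have hRinvtop : ∀ z, meromorphicOrderAt R⁻¹ z ≠ ⊤ := fun z h => by
    rw [meromorphicOrderAt_inv] at h
    exact hRtop z (by simpa using h)
  have h1 := characteristic_mul_top_le hr (meromorphic_of_differentiable hEd) hEtop hRm.inv hRinvtop
  rw [← hfactor, Pi.add_apply] at h1
  have h2 : characteristic E ⊤ r ≤ (L * 2 + Real.pi / 2 + Real.log 2) * r := by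
    refine (characteristic_top_le_of_differentiable hEd (b := fun _ => (L * 2 + Real.pi / 2 + Real.log 2) * r)
      continuous_const ?_).trans (le_of_eq (Real.circleAverage_const _ _ _))
    intro s hs
    rw [abs_of_pos hr0] at hs
    have hn1 := norm_powerFactor_le hq s
    have hn2 := norm_trigFactor_le hδ s
    rw [hs] at hn1 hn2
    have hl2 : 0 < Real.log 2 := Real.log_pos (by norm_num)
    rw [Real.posLog_apply]
    refine max_le (by positivity) ?_
    rcases (norm_nonneg (E s)).eq_or_lt with h0 | h0
    · rw [← h0, Real.log_zero]; positivity
    · have h3 : ‖E s‖ ≤ Real.exp (L * (1 + r)) * (2 * Real.exp (Real.pi / 2 * r)) := by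
        rw [norm_mul]; gcongr
      have h4 := Real.log_le_log h0 h3
      rw [Real.log_mul (Real.exp_pos _).ne' (by positivity), Real.log_exp,
        Real.log_mul two_ne_zero (Real.exp_pos _).ne', Real.log_exp] at h4
      nlinarith
  have h3 : characteristic R ⊤ r ≤ r / Real.pi * Real.log (r + 1) + (Real.pi * r + B) := by
    have hc1 : Continuous fun s : ℂ => max s.re 0 := continuous_re.max continuous_const
    refine (characteristic_top_le_of_differentiable hRd (b := fun s => Real.log (r + 1) • max s.re 0 + (Real.pi * r + B))
      ((continuous_const.mul hc1).add continuous_const) ?_).trans (le_of_eq ?_)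
    · intro s hs
      rw [abs_of_pos hr0] at hs
      refine (hΓ r s hs).trans (le_of_eq ?_)
      rw [smul_eq_mul]; ring
    · have e := Real.circleAverage_add (f₁ := fun s : ℂ => Real.log (r + 1) • max s.re 0)
        (f₂ := fun _ => Real.pi * r + B) (c := 0) (R := r)
        ((continuous_const.mul hc1).continuousOn.circleIntegrable') (circleIntegrable_const _ _ _)
      refine Eq.trans e ?_
      rw [Real.circleAverage_const, Real.circleAverage_fun_smul, circleAverage_max_re hr0.le, smul_eq_mul]
      ring
  have h4 := abs_le.1 (characteristic_sub_characteristic_inv_le hRm (R := r))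
  have h5 := log_add_one_le hr
  have h6 : r / Real.pi * Real.log (r + 1) ≤ r * Real.log r / Real.pi + 1 / Real.pi := by
    have : r / Real.pi * Real.log (r + 1) ≤ r / Real.pi * (Real.log r + 1 / r) := by gcongr
    refine this.trans (le_of_eq ?_)
    field_simp
  have h7 : 0 ≤ 1 / Real.pi := by positivity
  nlinarith [h4.1]

lemma characteristic_sin_le {r : ℝ} (hr : 0 ≤ r) :
    characteristic (fun s : ℂ => Complex.sin (Real.pi * s)) ⊤ r ≤ Real.pi * r := by
  have hpi := Real.pi_pos
  refine (characteristic_top_le_of_differentiable differentiable_sin_pi (b := fun _ => Real.pi * r)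
    continuous_const ?_).trans (le_of_eq (Real.circleAverage_const _ _ _))
  intro s hs
  rw [abs_of_nonneg hr] at hs
  rw [Real.posLog_apply]
  refine max_le (by positivity) ?_
  have h1 : ‖Complex.sin (Real.pi * s)‖ ≤ Real.exp (Real.pi * r) := by
    refine (norm_sin_le_exp _).trans (Real.exp_le_exp.2 ?_)
    rw [im_ofReal_mul, abs_mul, abs_of_pos hpi, ← hs]
    gcongr
    exact abs_im_le_norm s
  rcases (norm_nonneg (Complex.sin (Real.pi * s))).eq_or_lt with h0 | h0
  · rw [← h0, Real.log_zero]; positivity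
  · exact (Real.log_le_log h0 h1).trans_eq (Real.log_exp _)

lemma order_sin_ne_top (z : ℂ) :
    meromorphicOrderAt (fun s : ℂ => Complex.sin (Real.pi * s)) z ≠ ⊤ :=
  order_ne_top_of_differentiable differentiable_sin_pi (z₀ := 1 / 2)
    (by rw [mul_one_div, Complex.sin_pi_div_two]; exact one_ne_zero) z

lemma exists_logCounting_sin_le : ∃ c : ℝ, ∀ r : ℝ, 1 ≤ r →
    logCounting (fun s : ℂ => Complex.sin (Real.pi * s)) 0 r ≤ c * r := by
  obtain ⟨c, hc⟩ := logCounting_zero_le_characteristic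
    (meromorphic_of_differentiable differentiable_sin_pi)
  refine ⟨Real.pi + |c|, fun r hr => ?_⟩
  have h1 := hc r
  have h2 := characteristic_sin_le (r := r) (by linarith)
  nlinarith [le_abs_self c, abs_nonneg c]

/-- `Δ` has few poles. -/
lemma exists_logCounting_top_le (hq : 0 < q)
    (hord : ∀ z, meromorphicOrderAt (DeltaFactor q δ) z ≠ ⊤) :
    ∃ c : ℝ, ∀ r : ℝ, 1 ≤ r → logCounting (DeltaFactor q δ) ⊤ r ≤ c * r := by
  obtain ⟨c, hc⟩ := exists_logCounting_sin_le
  refine ⟨c, fun r hr => le_trans (logCounting_top_le_of_mul_eq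
    (h := fun s => powerFactor q s * trigFactor δ s * (Real.pi * (Gamma s)⁻¹))
    (meromorphic hq δ) hord
    differentiable_sin_pi order_sin_ne_top
    ((differentiable_numerator hq δ).mul (differentiable_one_div_Gamma.const_mul _)) ?_ hr) (hc r hr)⟩
  intro s hs
  have h := Gamma_mul_Gamma_one_sub s
  have hpi : (Real.pi : ℂ) ≠ 0 := by exact_mod_cast Real.pi_ne_zero
  have hΓ : Gamma s ≠ 0 := fun h0 => by
    rw [h0, zero_mul] at h
    exact div_ne_zero hpi hs h.symm
  rw [eq_div_iff hs] at h
  -- Multiplication by `sin πs` clears the poles of `Γ(1-s)` and leaves an entire function.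
  have e : (Real.pi : ℂ) * (Gamma s)⁻¹ = Gamma (1 - s) * Complex.sin (Real.pi * s) := by
    rw [mul_inv_eq_iff_eq_mul₀ hΓ]
    linear_combination -h
  rw [eq_powerFactor_mul, e]
  ring

/-- `Δ` has few zeros. -/
lemma exists_logCounting_zero_le (hq : 0 < q) (hδ : δ = 1 ∨ δ = -1)
    (hord : ∀ z, meromorphicOrderAt (DeltaFactor q δ) z ≠ ⊤) :
    ∃ c : ℝ, ∀ r : ℝ, 1 ≤ r → logCounting (DeltaFactor q δ) 0 r ≤ c * r := by
  obtain ⟨c, hc⟩ := exists_logCounting_sin_le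
  refine ⟨c, fun r hr => le_trans ?_ (hc r hr)⟩
  rw [← logCounting_inv]
  refine logCounting_top_le_of_mul_eq
    (h := fun s => (powerFactor q s)⁻¹ * (Gamma (1 - s))⁻¹ * (trigFactor (-δ) s / (2 * I)))
    (meromorphic hq δ).inv (fun z h => by
      rw [meromorphicOrderAt_inv] at h
      exact hord z (by simpa using h))
    differentiable_sin_pi order_sin_ne_top
    ((((differentiable_powerFactor hq).inv (powerFactor_ne_zero hq)).mul
      differentiable_inv_Gamma_one_sub).mul ((differentiable_trigFactor _).div_const _)) ?_ hr
  intro s hs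
  have h := trigFactor_mul_trigFactor_neg hδ s
  have h2I : (2 * I : ℂ) ≠ 0 := mul_ne_zero two_ne_zero I_ne_zero
  have ht : trigFactor δ s ≠ 0 := fun h0 => by
    rw [h0, zero_mul] at h
    exact mul_ne_zero h2I hs h.symm
  have e : Complex.sin (Real.pi * s) = trigFactor δ s * trigFactor (-δ) s / (2 * I) := by
    rw [h, mul_div_cancel_left₀ _ h2I]
  rw [e, Pi.inv_apply, eq_powerFactor_mul, mul_inv, mul_inv]
  field_simp

end DeltaFactor

/-! ### Lower bounds for the integrated counting function -/

/-- Summation by parts for a logarithmic counting function. -/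
lemma integral_le_sum_log_sub_log {ι : Type*} (P : Finset ι) (x : ι → ℝ) {r : ℝ} (hr : 1 ≤ r)
    (hx : ∀ i ∈ P, 1 ≤ x i ∧ x i ≤ r) {g : ℝ → ℝ} (hg : ContinuousOn g (Set.Icc 1 r))
    (h : ∀ u ∈ Set.Ioc 1 r, u * g u ≤ ((P.filter fun i => x i < u).card : ℝ)) :
    ∫ u in (1 : ℝ)..r, g u ≤ ∑ i ∈ P, (Real.log r - Real.log (x i)) := by
  have hcont : ContinuousOn (fun u : ℝ => u⁻¹) (Set.Icc 1 r) :=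
    continuousOn_inv₀.mono fun u hu => by
      have := hu.1
      show u ≠ 0
      linarith
  have hint : MeasureTheory.IntegrableOn (fun u : ℝ => u⁻¹) (Set.Ioc 1 r) :=
    (hcont.integrableOn_compact isCompact_Icc).mono_set Set.Ioc_subset_Icc_self
  -- Each term is the integral of `1/u` over `x i < u ≤ r`; summing under the integral sign produces
  -- the counting function divided by `u`.
  have hterm : ∀ i ∈ P, Real.log r - Real.log (x i)
      = ∫ u in Set.Ioc 1 r, (Set.Ioi (x i)).indicator (fun u : ℝ => u⁻¹) u := by
    intro i hi
    obtain ⟨h1, h2⟩ := hx i hi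
    rw [MeasureTheory.setIntegral_indicator measurableSet_Ioi, Set.Ioc_inter_Ioi, max_eq_right h1,
      ← intervalIntegral.integral_of_le h2, integral_inv_of_pos (by linarith) (by linarith),
      Real.log_div (by linarith) (by linarith)]
  rw [Finset.sum_congr rfl hterm, intervalIntegral.integral_of_le hr,
    ← MeasureTheory.integral_finsetSum P fun i _ => hint.indicator measurableSet_Ioi]
  refine MeasureTheory.setIntegral_mono_on
    ((hg.integrableOn_compact isCompact_Icc).mono_set Set.Ioc_subset_Icc_self)
    (MeasureTheory.integrable_finsetSum P fun i _ => hint.indicator measurableSet_Ioi)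
    measurableSet_Ioc fun u hu => ?_
  have hu0 : 0 < u := by linarith [hu.1]
  have e : ∑ i ∈ P, (Set.Ioi (x i)).indicator (fun u : ℝ => u⁻¹) u
      = ((P.filter fun i => x i < u).card : ℝ) * u⁻¹ := by
    simp only [Set.indicator_apply, Set.mem_Ioi]
    rw [← Finset.sum_filter, Finset.sum_const, nsmul_eq_mul]
  rw [e, ← div_eq_mul_inv, le_div_iff₀ hu0, mul_comm]
  exact h u hu

lemma integral_log_div_sub (r M : ℝ) :
    ∫ u in (1 : ℝ)..r, (Real.log u / (2 * Real.pi) - M)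
      = (r * Real.log r - r + 1) / (2 * Real.pi) - M * (r - 1) := by
  have h1 : IntervalIntegrable (fun u : ℝ => Real.log u / (2 * Real.pi)) MeasureTheory.volume 1 r :=
    intervalIntegral.intervalIntegrable_log'.div_const _
  rw [intervalIntegral.integral_sub h1 (by simp), intervalIntegral.integral_div, integral_log,
    intervalIntegral.integral_const, Real.log_one, smul_eq_mul]
  ring

/-- A finite set of `a`-points in a disc gives a lower bound for the integrated counting function. -/
lemma sum_le_logCounting {F : ℂ → ℂ} (hF : Meromorphic F) {a : ℂ}
    (hord : ∀ z, meromorphicOrderAt (fun z => F z - a) z ≠ ⊤) {r : ℝ} (hr : 1 ≤ r) (P : Finset ℂ)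
    (hP : ∀ z ∈ P, IsAPoint F a z ∧ ‖z‖ ≤ r) :
    ∑ z ∈ P, (Real.log r - Real.log ‖z‖) ≤ logCounting F a r := by
  classical
  have hm : Meromorphic fun z => F z - a := fun z => (hF z).sub (MeromorphicAt.const a z)
  -- Counting every point of `P` once gives a divisor below that of all `a`-points with
  -- multiplicity.
  have h1 : ∑ z ∈ P, Function.locallyFinsuppWithin.single z (1 : ℤ)
      ≤ (MeromorphicOn.divisor (fun z => F z - a) Set.univ)⁺ := by
    intro w
    rw [Function.locallyFinsuppWithin.coe_sum, Finset.sum_apply]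
    simp only [Function.locallyFinsuppWithin.single_apply]
    rw [Finset.sum_ite_eq]
    rw [Function.locallyFinsuppWithin.posPart_apply]
    split_ifs with hw
    · refine le_trans ?_ (le_posPart _)
      rw [MeromorphicOn.divisor_apply (fun z _ => hm z) (Set.mem_univ w)]
      have h2 := (hP w hw).1
      unfold IsAPoint at h2
      lift meromorphicOrderAt (fun z => F z - a) w to ℤ using hord w with n
      rw [WithTop.untop₀_coe]
      exact_mod_cast h2
    · exact posPart_nonneg _
  rw [logCounting_coe]
  refine le_trans (le_of_eq ?_) (Function.locallyFinsuppWithin.logCounting_le h1 hr)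
  rw [map_sum, Finset.sum_apply]
  refine Finset.sum_congr rfl fun z hz => ?_
  rw [Function.locallyFinsuppWithin.logCounting_single_eq_log_sub_const (hP z hz).2]
  simp

namespace IsCriticalPhase

variable {F G : ℂ → ℂ} {κ C : ℝ}

/-- The shape in `T + 1` is prepared for summation by parts with `u = T + 1`, where `|s| ≤ Im s + 1`
in the strip. -/
lemma exists_le_ncard (hG : IsCriticalPhase G κ C) (hF : Meromorphic F)
    (hexp : ∀ s : ℂ, 0 < s.im → F s = exp (-G s)) {a : ℂ} (ha : a ≠ 0) :
    ∃ M : ℝ, 0 ≤ M ∧ ∀ T : ℝ, 0 ≤ T →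
      (T + 1) * (Real.log (T + 1) / (2 * Real.pi) - M) ≤ (aPointsInStrip F a T).ncard := by
  obtain ⟨t₁, M, h1, -, hcount⟩ := hG.exists_count hexp ha (η := 1 / 4) (by norm_num) (by norm_num)
  have hpi := Real.pi_pos
  have hl1 : 0 ≤ Real.log (t₁ + 1) := Real.log_nonneg (by linarith)
  -- The first summand makes the left side nonpositive for `T < t₁`; the others absorb the linear
  -- and logarithmic errors beyond `t₁`.
  refine ⟨Real.log (t₁ + 1) / (2 * Real.pi) + |M| + (5 + |Real.log κ| + |C|) / (2 * Real.pi),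
    by positivity, fun T hT0 => ?_⟩
  rcases lt_or_ge T t₁ with hT | hT
  · refine le_trans ?_ (Nat.cast_nonneg _)
    refine mul_nonpos_of_nonneg_of_nonpos (by linarith) ?_
    have h2 : Real.log (T + 1) / (2 * Real.pi) ≤ Real.log (t₁ + 1) / (2 * Real.pi) := by
      gcongr
    have : 0 ≤ |M| + (5 + |Real.log κ| + |C|) / (2 * Real.pi) := by positivity
    linarith
  · have hsub : {s : ℂ | F s = a ∧ 0 < s.re ∧ s.re < 1 ∧ t₁ < s.im ∧ s.im < T}
        ⊆ aPointsInStrip F a T := by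
      rintro s ⟨hs, hs0, hs1, hst, hsT⟩
      exact ⟨(hG.isAPoint_iff hexp (by linarith) a).2 hs, hs0, hs1, by linarith, hsT⟩
    have h2 : (({s : ℂ | F s = a ∧ 0 < s.re ∧ s.re < 1 ∧ t₁ < s.im ∧ s.im < T}.ncard : ℕ) : ℝ)
        ≤ (aPointsInStrip F a T).ncard := by
      exact_mod_cast Set.ncard_le_ncard hsub (hG.finite_aPointsInStrip hF hexp a T)
    have h3 := (abs_le.1 (hcount T hT)).1
    have hT1 : 1 ≤ T := h1.trans hT
    rw [Real.log_mul hG.pos.ne' (by linarith)] at h3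
    have h4 : Real.log (T + 1) ≤ Real.log T + 1 / T := DeltaFactor.log_add_one_le hT1
    have hlT : 0 ≤ Real.log T := Real.log_nonneg hT1
    have hlT' : Real.log T ≤ T - 1 := Real.log_le_sub_one_of_pos (by linarith)
    have h5 : (T + 1) * Real.log (T + 1) ≤ T * Real.log T + 4 * T := by
      have : (T + 1) * Real.log (T + 1) ≤ (T + 1) * (Real.log T + 1 / T) := by gcongr
      refine this.trans ?_
      have e : (T + 1) * (1 / T) = 1 + 1 / T := by field_simp
      have : 1 / T ≤ 1 := by rw [div_le_one (by linarith)]; exact hT1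
      nlinarith
    have h6 : C / (2 * Real.pi) * Real.log T ≤ |C| / (2 * Real.pi) * T := by
      refine mul_le_mul ?_ (by linarith) hlT (by positivity)
      gcongr
      exact le_abs_self C
    have h7 : -(|Real.log κ| * T) ≤ T * Real.log κ := by
      nlinarith [neg_abs_le (Real.log κ)]
    have h8 : M ≤ |M| * (T + 1) := by nlinarith [le_abs_self M, abs_nonneg M]
    set p := 2 * Real.pi
    have hp : 0 < p := by positivity
    have e1 : (T + 1) * (Real.log (T + 1) / p
        - (Real.log (t₁ + 1) / p + |M| + (5 + |Real.log κ| + |C|) / p))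
        = ((T + 1) * Real.log (T + 1)) / p - (T + 1) * (Real.log (t₁ + 1) / p) - |M| * (T + 1)
          - ((5 + |Real.log κ| + |C|) / p) * (T + 1) := by ring
    have e2 : T / p * (Real.log κ + Real.log T - 1)
        = (T * Real.log κ) / p + (T * Real.log T) / p - T / p := by ring
    have h9 : ((T + 1) * Real.log (T + 1)) / p ≤ (T * Real.log T + 4 * T) / p := by gcongr
    have h10 : -(|Real.log κ| * T) / p ≤ (T * Real.log κ) / p := by gcongr
    have h11 : 0 ≤ (T + 1) * (Real.log (t₁ + 1) / p) := by positivity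
    have e3 : ((5 + |Real.log κ| + |C|) / p) * (T + 1)
        = 5 * T / p + |Real.log κ| * T / p + |C| / p * T + (5 + |Real.log κ| + |C|) / p := by ring
    have e4 : (T * Real.log T + 4 * T) / p = (T * Real.log T) / p + 4 * T / p := by ring
    have e5 : -(|Real.log κ| * T) / p = -(|Real.log κ| * T / p) := by ring
    have e6 : 5 * T / p = 4 * T / p + T / p := by ring
    have h13 : 0 ≤ (5 + |Real.log κ| + |C|) / p := by positivity
    rw [e1]
    rw [e2] at h3
    rw [e4] at h9
    rw [e5] at h10
    linarith

/-- The logarithmic sum over the `a`-points in the upper half of the critical strip. -/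
lemma exists_le_sum_log (hG : IsCriticalPhase G κ C) (hF : Meromorphic F)
    (hexp : ∀ s : ℂ, 0 < s.im → F s = exp (-G s)) {a : ℂ} (ha : a ≠ 0) :
    ∃ M : ℝ, ∀ r : ℝ, 1 ≤ r → ∃ P : Finset ℂ,
      (∀ s ∈ P, F s = a ∧ 0 < s.im ∧ ‖s‖ ≤ r) ∧
      r * Real.log r / (2 * Real.pi) - M * r ≤ ∑ s ∈ P, (Real.log r - Real.log ‖s‖) := by
  classical
  obtain ⟨M, hM, hcount⟩ := hG.exists_le_ncard hF hexp ha
  have hpi := Real.pi_pos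
  refine ⟨M + 1 / (2 * Real.pi), fun r hr => ?_⟩
  have hfin := hG.finite_aPointsInStrip hF hexp a
  have hnorm : ∀ s ∈ aPointsInStrip F a (r - 1), ‖s‖ ≤ s.im + 1 := by
    rintro s ⟨-, h0, h1, h2, -⟩
    refine (norm_le_abs_re_add_abs_im s).trans ?_
    rw [abs_of_pos h0, abs_of_pos h2]
    linarith
  refine ⟨(hfin (r - 1)).toFinset, fun s hs => ?_, ?_⟩
  · rw [Set.Finite.mem_toFinset] at hs
    have h1 := hnorm s hs
    obtain ⟨h2, -, -, h3, h4⟩ := hs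
    exact ⟨(hG.isAPoint_iff hexp h3 a).1 h2, h3, by linarith⟩
  have key := integral_le_sum_log_sub_log (hfin (r - 1)).toFinset (fun s => s.im + 1) hr
    (g := fun u => Real.log u / (2 * Real.pi) - M)
    (fun s hs => by
      rw [Set.Finite.mem_toFinset] at hs
      obtain ⟨-, -, -, h3, h4⟩ := hs
      constructor <;> linarith)
    (((Real.continuousOn_log.mono fun u hu => by
      have := hu.1
      show u ≠ 0
      linarith).div_const _).sub continuousOn_const)
    (fun u hu => by
      have h1 := hcount (u - 1) (by linarith [hu.1])
      rw [sub_add_cancel] at h1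
      refine h1.trans (le_of_eq ?_)
      rw [Set.ncard_eq_toFinset_card _ (hfin (u - 1))]
      congr 2
      ext s
      simp only [Set.Finite.mem_toFinset, Finset.mem_filter]
      constructor
      · rintro ⟨h2, h3, h4, h5, h6⟩
        exact ⟨⟨h2, h3, h4, h5, by linarith [hu.2]⟩, by linarith⟩
      · rintro ⟨⟨h2, h3, h4, h5, -⟩, h6⟩
        exact ⟨h2, h3, h4, h5, by linarith⟩)
  rw [integral_log_div_sub] at key
  have h2 : ∑ s ∈ (hfin (r - 1)).toFinset, (Real.log r - Real.log (s.im + 1))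
      ≤ ∑ s ∈ (hfin (r - 1)).toFinset, (Real.log r - Real.log ‖s‖) := by
    refine Finset.sum_le_sum fun s hs => ?_
    rw [Set.Finite.mem_toFinset] at hs
    have h0 : s ≠ 0 := fun h => by
      have := hs.2.1
      simp [h] at this
    have := Real.log_le_log (norm_pos_iff.2 h0) (hnorm s hs)
    linarith
  refine le_trans ?_ (key.trans h2)
  have e : (r * Real.log r - r + 1) / (2 * Real.pi) - M * (r - 1)
      = r * Real.log r / (2 * Real.pi) - (M + 1 / (2 * Real.pi)) * r + (M + 1 / (2 * Real.pi)) := by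
    ring
  rw [e]
  have : 0 ≤ M + 1 / (2 * Real.pi) := by positivity
  linarith

end IsCriticalPhase

/-! ### Deficiencies of Δ, and the theorem -/

namespace DeltaFactor

variable {q : ℕ} {δ : ℤ}

lemma exists_isCriticalPhase (hq : 0 < q) (hδ : δ = 1 ∨ δ = -1) :
    ∃ G : ℂ → ℂ, IsCriticalPhase G (q / (2 * Real.pi)) 7 ∧
      ∀ s : ℂ, 0 < s.im → DeltaFactor q δ s = exp (-G s) := by
  obtain ⟨G, hG⟩ := exists_eq_exp_neg (q := q) hq hδ
  refine ⟨G, ⟨by positivity, fun s hs => (hG s hs).1.differentiableAt, ?_, ?_⟩, fun s hs => (hG s hs).2⟩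
  · intro s h0 h1 hs
    rw [(hG s (by linarith)).1.deriv, ← norm_neg, neg_sub, sub_neg_eq_add, add_comm]
    exact norm_logDeriv_add_log_le hq hδ h0 h1 hs
  · intro t ht
    have h1 := norm_half_add_mul_I (q := q) hq hδ t
    rw [(hG _ (by simpa using ht)).2, norm_exp, neg_re, Real.exp_eq_one_iff] at h1
    linarith

lemma analyticAt (hq : 0 < q) {s : ℂ} (hs : s.im ≠ 0) : AnalyticAt ℂ (DeltaFactor q δ) s := by
  have hopen : IsOpen {s : ℂ | s.im ≠ 0} := isOpen_ne_fun continuous_im continuous_const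
  have : DifferentiableOn ℂ (DeltaFactor q δ) {s : ℂ | s.im ≠ 0} := fun z hz =>
    (differentiableAt hq hz).differentiableWithinAt
  exact this.analyticAt (hopen.mem_nhds hs)

lemma order_sub_ne_top (hq : 0 < q) (hδ : δ = 1 ∨ δ = -1) (a s : ℂ) :
    meromorphicOrderAt (fun z => DeltaFactor q δ z - a) s ≠ ⊤ := by
  obtain ⟨G, hG, hexp⟩ := exists_isCriticalPhase hq hδ
  exact hG.order_sub_ne_top (meromorphic hq δ) hexp a s

/-- The lower bound for the integrated counting function of the `a`-points of `Δ`. -/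
lemma exists_le_logCounting (hq : 0 < q) (hδ : δ = 1 ∨ δ = -1) {a : ℂ} (ha : a ≠ 0) :
    ∃ M : ℝ, ∀ r : ℝ, 1 ≤ r →
      r * Real.log r / Real.pi - M * r ≤ logCounting (DeltaFactor q δ) a r := by
  classical
  obtain ⟨G, hG, hexp⟩ := exists_isCriticalPhase hq hδ
  have hδ0 : (δ : ℂ) ≠ 0 := by rcases hδ with rfl | rfl <;> simp
  have hδ2 : (δ : ℂ) * δ = 1 := by rcases hδ with rfl | rfl <;> simp
  -- By the reflection symmetry, `a`-points in the lower half plane are conjugates of `δ ā`-points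
  -- in the upper one. Each half contributes `r log r / (2π)`.
  have ha' : (δ : ℂ) * starRingEnd ℂ a ≠ 0 := mul_ne_zero hδ0 (by simpa using ha)
  obtain ⟨M₁, h₁⟩ := hG.exists_le_sum_log (meromorphic hq δ) hexp ha
  obtain ⟨M₂, h₂⟩ := hG.exists_le_sum_log (meromorphic hq δ) hexp ha'
  refine ⟨M₁ + M₂, fun r hr => ?_⟩
  obtain ⟨P₁, hP₁, hs₁⟩ := h₁ r hr
  obtain ⟨P₂, hP₂, hs₂⟩ := h₂ r hr
  have hinj : Function.Injective (starRingEnd ℂ) := (starRingEnd ℂ).injective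
  have hdisj : Disjoint P₁ (P₂.image (starRingEnd ℂ)) := by
    rw [Finset.disjoint_left]
    intro s hs hs'
    obtain ⟨w, hw, rfl⟩ := Finset.mem_image.1 hs'
    have h3 := (hP₁ _ hs).2.1
    have h4 := (hP₂ _ hw).2.1
    rw [conj_im] at h3
    linarith
  have hsum : ∑ s ∈ P₁ ∪ P₂.image (starRingEnd ℂ), (Real.log r - Real.log ‖s‖)
      = ∑ s ∈ P₁, (Real.log r - Real.log ‖s‖) + ∑ s ∈ P₂, (Real.log r - Real.log ‖s‖) := by
    rw [Finset.sum_union hdisj, Finset.sum_image hinj.injOn]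
    simp only [RCLike.norm_conj]
  have key := sum_le_logCounting (meromorphic hq δ) (order_sub_ne_top hq hδ a) hr
    (P₁ ∪ P₂.image (starRingEnd ℂ)) (fun z hz => by
      rcases Finset.mem_union.1 hz with hz | hz
      · obtain ⟨h3, h4, h5⟩ := hP₁ z hz
        exact ⟨(isAPoint_iff_of_analyticAt (analyticAt hq h4.ne') a).2 h3, h5⟩
      · obtain ⟨w, hw, rfl⟩ := Finset.mem_image.1 hz
        obtain ⟨h3, h4, h5⟩ := hP₂ w hw
        refine ⟨(isAPoint_iff_of_analyticAt (analyticAt hq ?_) a).2 ?_, by rwa [RCLike.norm_conj]⟩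
        · rw [conj_im]; exact neg_ne_zero.2 h4.ne'
        · rw [conj_apply hq hδ, h3, map_mul, conj_conj, map_intCast, ← mul_assoc, hδ2, one_mul])
  rw [hsum] at key
  have e : r * Real.log r / Real.pi - (M₁ + M₂) * r
      = (r * Real.log r / (2 * Real.pi) - M₁ * r) + (r * Real.log r / (2 * Real.pi) - M₂ * r) := by
    field_simp
    ring
  rw [e]
  linarith

/-- The First Main Theorem for `Δ - a`, whose characteristic differs from that of `Δ` by a bounded
amount. -/
lemma exists_logCounting_le_characteristic (hq : 0 < q) (a : ℂ) :
    ∃ c : ℝ, ∀ r, logCounting (DeltaFactor q δ) a r ≤ characteristic (DeltaFactor q δ) ⊤ r + c := by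
  have hm : Meromorphic (fun z => DeltaFactor q δ z - a) := fun z =>
    (meromorphic hq δ z).sub (MeromorphicAt.const a z)
  obtain ⟨c, hc⟩ := logCounting_zero_le_characteristic hm
  refine ⟨c + (Real.posLog ‖a‖ + Real.log 2), fun r => ?_⟩
  have h1 := (abs_le.1 (abs_characteristic_sub_characteristic_shift_le (a₀ := a) (r := r)
    (meromorphic hq δ))).1
  have h2 : logCounting (DeltaFactor q δ) a r = logCounting (fun z => DeltaFactor q δ z - a) 0 r := by
    rw [logCounting_coe_eq_logCounting_sub_const_zero]; rfl
  have := hc r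
  linarith

lemma tendsto_div_of_le (f : ℝ → ℝ) {c₁ c₂ A : ℝ}
    (h₁ : ∀ r, 1 ≤ r → A * (r * Real.log r / Real.pi) - c₁ * r ≤ f r)
    (h₂ : ∀ r, 1 ≤ r → f r ≤ A * (r * Real.log r / Real.pi) + c₂ * r) :
    Tendsto (fun r => f r / (r * Real.log r / Real.pi)) atTop (𝓝 A) := by
  have hpi := Real.pi_pos
  have hlog : ∀ c : ℝ, Tendsto (fun r : ℝ => A + c * Real.pi * (Real.log r)⁻¹) atTop (𝓝 A) := by
    intro c
    have := ((Real.tendsto_log_atTop.inv_tendsto_atTop).const_mul (c * Real.pi)).const_add A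
    simpa using this
  refine tendsto_of_tendsto_of_tendsto_of_le_of_le' (hlog (-c₁)) (hlog c₂) ?_ ?_
  · filter_upwards [eventually_gt_atTop 1] with r hr
    have hr0 : 0 < r := by linarith
    have hl : 0 < Real.log r := Real.log_pos hr
    rw [le_div_iff₀ (by positivity)]
    refine le_trans (le_of_eq ?_) (h₁ r hr.le)
    field_simp
    ring
  · filter_upwards [eventually_gt_atTop 1] with r hr
    have hr0 : 0 < r := by linarith
    have hl : 0 < Real.log r := Real.log_pos hr
    rw [div_le_iff₀ (by positivity)]
    refine (h₂ r hr.le).trans (le_of_eq ?_)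
    field_simp

/-- The asymptotics of the Nevanlinna characteristic of `Δ`. -/
lemma tendsto_characteristic_div (hq : 0 < q) (hδ : δ = 1 ∨ δ = -1) :
    Tendsto (fun r => characteristic (DeltaFactor q δ) ⊤ r / (r * Real.log r / Real.pi)) atTop
      (𝓝 1) := by
  -- Any nonzero value would do: its counting function bounds the characteristic from below.
  obtain ⟨M, hM⟩ := exists_le_logCounting (q := q) hq hδ one_ne_zero
  obtain ⟨c, hc⟩ := exists_logCounting_le_characteristic (δ := δ) hq 1
  obtain ⟨c', hc'⟩ := exists_characteristic_le (q := q) hq hδ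
  refine tendsto_div_of_le _ (c₁ := M + |c|) (c₂ := c') (fun r hr => ?_) (fun r hr => ?_)
  · have h1 := hM r hr
    have h2 := hc r
    nlinarith [le_abs_self c, abs_nonneg c]
  · rw [one_mul]
    exact hc' r hr

lemma deficiency_eq_of_tendsto (hq : 0 < q) (hδ : δ = 1 ∨ δ = -1) {a : WithTop ℂ} {A : ℝ}
    (h : Tendsto (fun r => logCounting (DeltaFactor q δ) a r / (r * Real.log r / Real.pi)) atTop
      (𝓝 A)) : nevanlinnaDeficiency (DeltaFactor q δ) a = 1 - A := by
  have h1 := h.div (tendsto_characteristic_div (q := q) hq hδ) one_ne_zero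
  rw [div_one] at h1
  have h2 : Tendsto (fun r => logCounting (DeltaFactor q δ) a r
      / characteristic (DeltaFactor q δ) ⊤ r) atTop (𝓝 A) := by
    refine h1.congr' ?_
    filter_upwards [eventually_gt_atTop 1] with r hr
    have hl : 0 < Real.log r := Real.log_pos hr
    have hpi := Real.pi_pos
    have : r * Real.log r / Real.pi ≠ 0 := by positivity
    exact div_div_div_cancel_right₀ this _ _
  rw [nevanlinnaDeficiency, h2.limsup_eq]

lemma deficiency_eq_zero (hq : 0 < q) (hδ : δ = 1 ∨ δ = -1) {a : ℂ} (ha : a ≠ 0) :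
    nevanlinnaDeficiency (DeltaFactor q δ) a = 0 := by
  obtain ⟨M, hM⟩ := exists_le_logCounting (q := q) hq hδ ha
  obtain ⟨c, hc⟩ := exists_logCounting_le_characteristic (δ := δ) hq a
  obtain ⟨c', hc'⟩ := exists_characteristic_le (q := q) hq hδ
  rw [deficiency_eq_of_tendsto hq hδ (A := 1), sub_self]
  refine tendsto_div_of_le _ (c₁ := M) (c₂ := c' + |c|) (fun r hr => ?_) (fun r hr => ?_)
  · rw [one_mul]
    exact hM r hr
  · have h1 := hc' r hr
    have h2 := hc r
    nlinarith [le_abs_self c, abs_nonneg c]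

/-- A linear counting function is negligible against `T(r) ~ r log r / π`. -/
lemma deficiency_eq_one (hq : 0 < q) (hδ : δ = 1 ∨ δ = -1) {a : WithTop ℂ} {c : ℝ}
    (h : ∀ r : ℝ, 1 ≤ r → logCounting (DeltaFactor q δ) a r ≤ c * r) :
    nevanlinnaDeficiency (DeltaFactor q δ) a = 1 := by
  rw [deficiency_eq_of_tendsto hq hδ (A := 0), sub_zero]
  refine tendsto_div_of_le _ (c₁ := 0) (c₂ := c) (fun r hr => ?_) (fun r hr => ?_)
  · simpa using logCounting_nonneg hr
  · simpa using h r hr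

theorem isNevanlinnaExceptional_iff (hq : 0 < q) (hδ : δ = 1 ∨ δ = -1) (a : WithTop ℂ) :
    IsNevanlinnaExceptional (DeltaFactor q δ) a ↔ a = 0 ∨ a = ⊤ := by
  have hord : ∀ z, meromorphicOrderAt (DeltaFactor q δ) z ≠ ⊤ := fun z => by
    simpa using order_sub_ne_top (q := q) hq hδ 0 z
  unfold IsNevanlinnaExceptional
  induction a using WithTop.recTopCoe with
  | top =>
    obtain ⟨c, hc⟩ := exists_logCounting_top_le hq hord
    rw [deficiency_eq_one hq hδ hc]
    simp
  | coe a =>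
    by_cases ha : a = 0
    · subst ha
      obtain ⟨c, hc⟩ := exists_logCounting_zero_le hq hδ hord
      rw [WithTop.coe_zero, deficiency_eq_one hq hδ hc]
      simp
    · rw [deficiency_eq_zero hq hδ ha]
      simp [ha]

end DeltaFactor

theorem theorem1 (q : ℕ) (hq : 0 < q) (f : ℤ → ℂ) (hper : Function.Periodic f (q : ℤ))
    (δ : ℤ) (hδ : δ = 1 ∨ δ = -1) (hparity : ∀ n : ℤ, f n = (δ : ℂ) * f (-n)) :
    Meromorphic (DeltaFactor q δ) ∧
    (∀ a : WithTop ℂ, IsNevanlinnaExceptional (DeltaFactor q δ) a ↔ a = 0 ∨ a = ⊤) ∧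
    IsJuliaLine (DeltaFactor q δ) (1 / 2) ∧
    ∀ a : ℂ, a ≠ 0 →
      (∀ T : ℝ, (aPointsInStrip (DeltaFactor q δ) a T).Finite) ∧
      (fun T : ℝ => (aPointCount (DeltaFactor q δ) a T : ℝ)
          - T / (2 * Real.pi) * Real.log ((q : ℝ) * T / (2 * Real.pi * Real.exp 1)))
        =O[Filter.atTop] (fun T : ℝ => Real.log T) := by
  have hm := DeltaFactor.meromorphic hq δ
  obtain ⟨G, hG, hexp⟩ := DeltaFactor.exists_isCriticalPhase hq hδ
  refine ⟨hm, DeltaFactor.isNevanlinnaExceptional_iff hq hδ, hG.isJuliaLine hexp, fun a ha =>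
    ⟨hG.finite_aPointsInStrip hm hexp a, ?_⟩⟩
  obtain ⟨t₁, M, hcount⟩ := hG.exists_aPointCount_bound hm hexp ha
  refine Asymptotics.IsBigO.of_bound (|M| + 7 / (2 * Real.pi)) ?_
  have hpi := Real.pi_pos
  -- For `T ≥ e` one has `log T ≥ 1`, so the constant `M` is absorbed into the logarithmic error.
  filter_upwards [eventually_gt_atTop t₁, eventually_ge_atTop (Real.exp 1)] with T hT hTe
  have hT0 : 0 < T := (Real.exp_pos 1).trans_le hTe
  have hlog : 1 ≤ Real.log T := (Real.le_log_iff_exp_le hT0).2 hTe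
  have hq0 : (0 : ℝ) < q := by exact_mod_cast hq
  have e : Real.log ((q : ℝ) * T / (2 * Real.pi * Real.exp 1))
      = Real.log (q / (2 * Real.pi) * T) - 1 := by
    rw [show (q : ℝ) * T / (2 * Real.pi * Real.exp 1) = (q / (2 * Real.pi) * T) / Real.exp 1 by
      field_simp, Real.log_div (by positivity) (Real.exp_pos 1).ne', Real.log_exp]
  rw [e, Real.norm_eq_abs, Real.norm_of_nonneg (by linarith : 0 ≤ Real.log T)]
  refine (hcount T hT).trans ?_
  nlinarith [le_abs_self M, abs_nonneg M]
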